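/- Let $M$ be a smooth $n$-dimensional Riemannian manifold with Levi-Civita connection $\nabla$, and equip the exterior bundle $\Lambda^*T^*M=\bigoplus_p\Lambda^pT^*M$ with the connection induced by $\nabla$, its curvature $R(X,Y)=\nabla_X\nabla_Y-\nabla_Y\nabla_X-\nabla_{[X,Y]}$, and the Clifford multiplication by tangent vectors $v\cdot\omega=v^\flat\wedge\omega-\iota_v\omega$ (so that $v\cdot v\cdot\omega=-|v|^2\omega$). The Weitzenböck curvature operator of the exterior bundle is defined, for any smooth local orthonormal frame $e_1,\dots,e_n$ of $TM$, by $$\mathcal R\sigma=\sum_{i<j}e_i\cdot e_j\cdot R(e_i,e_j)\sigma .$$ If $M$ has constant sectional curvature $\kappa$, then $\mathcal R$ maps $p$-forms to $p$-forms, and for every $p$ and every (locally defined) smooth $p$-form $\varphi$, $$\mathcal R\varphi=\kappa\,p(n-p)\,\varphi .$$ -/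

import Mathlib

open Bundle Manifold VectorField
open scoped ContDiff

noncomputable section

namespace CliffordForms

/-- The action of an endomorphism `A` of `W` on `p`-forms:
`(w_1, …, w_p) ↦ ∑ i, φ(w_1, …, A w_i, …, w_p)`. -/
def derivationAction {W : Type*} [AddCommGroup W] [Module ℝ W] {p : ℕ} (A : W →ₗ[ℝ] W)
    (φ : W [⋀^Fin p]→ₗ[ℝ] ℝ) : W [⋀^Fin p]→ₗ[ℝ] ℝ where
  toFun w := ∑ i, φ (Function.update w i (A (w i)))
  map_update_add' := by
    intro inst w j a b
    obtain rfl : inst = instDecidableEqFin p := Subsingleton.elim _ _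
    rw [← Finset.sum_add_distrib]
    refine Finset.sum_congr rfl fun i _ => ?_
    by_cases h : i = j
    · subst h; simp
    · simp [Function.update_of_ne h, Function.update_comm (Ne.symm h)]
  map_update_smul' := by
    intro inst w j c a
    obtain rfl : inst = instDecidableEqFin p := Subsingleton.elim _ _
    rw [Finset.smul_sum]
    refine Finset.sum_congr rfl fun i _ => ?_
    by_cases h : i = j
    · subst h; simp
    · simp [Function.update_of_ne h, Function.update_comm (Ne.symm h)]
  map_eq_zero_of_eq' := by
    intro w i j hij hne
    change ∑ k, φ (Function.update w k (A (w k))) = 0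
    rw [Fintype.sum_eq_add i j hne]
    · have h : Function.update w j (A (w j)) =
          Function.update w i (A (w i)) ∘ Equiv.swap i j := by
        funext k
        rcases eq_or_ne k i with rfl | hi
        · simp [hne, hne.symm, hij]
        · rcases eq_or_ne k j with rfl | hj
          · simp [hij]
          · simp [hi, hj, Equiv.swap_apply_of_ne_of_ne hi hj]
      rw [h, AlternatingMap.map_swap _ _ hne, add_neg_cancel]
    · intro k hk
      refine φ.map_eq_zero_of_eq _ ?_ hne
      rw [Function.update_of_ne hk.1.symm, Function.update_of_ne hk.2.symm, hij]

/-! ### The exterior algebra of a Euclidean space as a Clifford module -/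

section Fiber

variable {V : Type*} [NormedAddCommGroup V] [InnerProductSpace ℝ V]

variable (V) in
/-- The exterior algebra `Λ* V*`, as families `(α_p)` of alternating `p`-forms on `V`. When
`dim V = n`, the components of degree `p > n` vanish, so this is `⨁_{p ≤ n} Λ^p V*`. -/
abbrev ExteriorForms : Type _ := ∀ p : ℕ, V [⋀^Fin p]→ₗ[ℝ] ℝ

/-- The covector `⟨v, ·⟩` tensored with a `p`-form `φ`: `w ↦ ⟨v, w⟩ φ`. -/
def flatTensor {p : ℕ} (v : V) (φ : V [⋀^Fin p]→ₗ[ℝ] ℝ) : V →ₗ[ℝ] V [⋀^Fin p]→ₗ[ℝ] ℝ :=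
  (innerₗ V v).smulRight φ

/-- The exterior product `v♭ ∧ φ`:
`(v♭ ∧ φ)(w_0, …, w_p) = ∑ i, (-1)^i ⟨v, w_i⟩ φ(w_0, …, ŵ_i, …, w_p)`. -/
def flatWedge {p : ℕ} (v : V) (φ : V [⋀^Fin p]→ₗ[ℝ] ℝ) : V [⋀^Fin (p + 1)]→ₗ[ℝ] ℝ :=
  AlternatingMap.alternatizeUncurryFin (flatTensor v φ)

/-- `v♭ ∧ α` for a form `α` of mixed degree. -/
def wedge (v : V) (α : ExteriorForms V) : ExteriorForms V
  | 0 => 0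
  | p + 1 => flatWedge v (α p)

/-- The interior product `ι_v α = α(v, …)` for a form `α` of mixed degree. -/
def contract (v : V) (α : ExteriorForms V) : ExteriorForms V :=
  fun p => (α (p + 1)).curryLeft v

theorem flatWedge_apply {p : ℕ} (v : V) (φ : V [⋀^Fin p]→ₗ[ℝ] ℝ) (w : Fin (p + 1) → V) :
    flatWedge v φ w = ∑ i : Fin (p + 1), (-1 : ℝ) ^ (i : ℕ) * (inner ℝ v (w i) *
      φ (i.removeNth w)) := by
  simp [flatWedge, flatTensor, AlternatingMap.alternatizeUncurryFin_apply]

/-- Clifford multiplication by a vector, `v · α = v♭ ∧ α - ι_v α`. -/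
def vectorMul : V →ₗ[ℝ] Module.End ℝ (ExteriorForms V) :=
  LinearMap.mk₂ ℝ (fun v α => wedge v α - contract v α)
    (by
      intro v v' α; funext p; ext w
      rcases p with _ | p <;>
        simp [wedge, contract, flatWedge_apply, inner_add_left, add_mul, mul_add,
          Finset.sum_add_distrib] <;> ring)
    (by
      intro c v α; funext p; ext w
      rcases p with _ | p <;>
        simp [wedge, contract, flatWedge_apply, inner_smul_left, mul_sub, Finset.mul_sum]
      refine Finset.sum_congr rfl fun i _ => by ring)
    (by
      intro v α α'; funext p; ext w
      rcases p with _ | p <;>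
        simp [wedge, contract, flatWedge_apply, mul_add, Finset.sum_add_distrib] <;> ring)
    (by
      intro c v α; funext p; ext w
      rcases p with _ | p <;>
        simp [wedge, contract, flatWedge_apply, mul_sub, Finset.mul_sum]
      refine Finset.sum_congr rfl fun i _ => by ring)

theorem vectorMul_apply (v : V) (α : ExteriorForms V) :
    vectorMul v α = wedge v α - contract v α := rfl

theorem wedge_sub (v : V) (α β : ExteriorForms V) : wedge v (α - β) = wedge v α - wedge v β := by
  funext p; ext w
  rcases p with _ | p <;> simp [wedge, flatWedge_apply, mul_sub, Finset.sum_sub_distrib]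

theorem contract_sub (v : V) (α β : ExteriorForms V) :
    contract v (α - β) = contract v α - contract v β := by
  funext p; ext w
  simp [contract]

theorem wedge_wedge (v : V) (α : ExteriorForms V) : wedge v (wedge v α) = 0 := by
  funext p
  rcases p with _ | _ | p
  · rfl
  · ext w
    simp [wedge, flatWedge_apply]
  · have := AlternatingMap.alternatizeUncurryFin_alternatizeUncurryFinLM_comp_of_symmetric
      (R := ℝ) (M := V) (N := ℝ) (f := (innerₗ V v).smulRight (flatTensor v (α p)))
      (by intro a b; simp [flatTensor, smul_smul, mul_comm])
    refine Eq.trans ?_ this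
    ext w
    simp [wedge, flatWedge, flatTensor, AlternatingMap.alternatizeUncurryFin_apply]

theorem contract_contract (v : V) (α : ExteriorForms V) : contract v (contract v α) = 0 := by
  funext p
  simp [contract]

theorem contract_wedge (v : V) (α : ExteriorForms V) :
    contract v (wedge v α) = (inner ℝ v v : ℝ) • α - wedge v (contract v α) := by
  funext p; ext w
  rcases p with _ | p
  · simp [contract, wedge, flatWedge_apply]
  · simp [contract, wedge, flatWedge_apply, Fin.sum_univ_succ (n := p + 1)]
    rw [sub_eq_add_neg, ← Finset.sum_neg_distrib]
    congr 1
    refine Finset.sum_congr rfl fun i _ => ?_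
    have h : i.succ.removeNth (Matrix.vecCons v w : Fin (p + 2) → V) =
        Matrix.vecCons v (i.removeNth w) := by
      funext j
      refine Fin.cases ?_ (fun k => ?_) j <;> simp [Fin.removeNth]
    rw [h]
    ring

variable (V) in
/-- The quadratic form `v ↦ -‖v‖²` defining the Clifford algebra. -/
def cliffordForm : QuadraticForm ℝ V := -LinearMap.BilinMap.toQuadraticMap (innerₗ V)

theorem vectorMul_mul_self (v : V) :
    vectorMul v * vectorMul v = algebraMap ℝ (Module.End ℝ (ExteriorForms V)) (cliffordForm V v) := by
  ext1 α
  have h₁ : wedge v (wedge v α - contract v α) = -wedge v (contract v α) := by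
    rw [wedge_sub, wedge_wedge, zero_sub]
  have h₂ : contract v (wedge v α - contract v α) = contract v (wedge v α) := by
    rw [contract_sub, contract_contract, sub_zero]
  simp [Module.End.mul_apply, vectorMul_apply, h₁, h₂, contract_wedge, cliffordForm,
    Algebra.algebraMap_eq_smul_one]
  abel

/-- The Clifford module structure on the exterior algebra: the algebra map
`Cℓ(V) → End(Λ* V*)` that sends a vector `v` to `α ↦ v♭ ∧ α - ι_v α`. -/
def cliffordAction : CliffordAlgebra (cliffordForm V) →ₐ[ℝ] Module.End ℝ (ExteriorForms V) :=
  CliffordAlgebra.lift (cliffordForm V) ⟨vectorMul, vectorMul_mul_self⟩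

end Fiber

/-! ### Riemannian manifolds: vector fields, forms, connections and curvature -/

section Manifold

variable {n : ℕ} {M : Type*} [TopologicalSpace M] [ChartedSpace (EuclideanSpace ℝ (Fin n)) M]

variable (n M) in
/-- Vector fields on `M`, with no regularity imposed. -/
abbrev VField : Type _ := ∀ x : M, TangentSpace (𝓡 n) x

variable (n M) in
/-- Fields of exterior `p`-forms on `M`, with no regularity imposed. -/
abbrev PForm (p : ℕ) : Type _ := ∀ x : M, TangentSpace (𝓡 n) x [⋀^Fin p]→ₗ[ℝ] ℝ

variable [IsManifold (𝓡 n) ∞ M]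

/-- The vector field `Y` is smooth at every point of `U`. -/
def VField.SmoothOn (Y : VField n M) (U : Set M) : Prop :=
  ContMDiffOn (𝓡 n) (𝓡 n).tangent ∞ (fun y => (⟨y, Y y⟩ : TangentBundle (𝓡 n) M)) U

/-- The `p`-form `φ` is smooth at (that is, near) `x`. -/
def PForm.SmoothAt {p : ℕ} (φ : PForm n M p) (x : M) : Prop :=
  ∀ Y : Fin p → VField n M,
    (∀ i, ContMDiffAt (𝓡 n) (𝓡 n).tangent ∞ (fun y => (⟨y, Y i y⟩ : TangentBundle (𝓡 n) M)) x) →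
    ContMDiffAt (𝓡 n) 𝓘(ℝ, ℝ) ∞ (fun y => φ y (fun i => Y i y)) x

/-- Extension of a tangent vector at `x` to a vector field that is constant in the chart at `x`
(and zero outside the domain of that chart). -/
def chartExt (x : M) : TangentSpace (𝓡 n) x →ₗ[ℝ] VField n M :=
  LinearMap.pi fun y =>
    ((trivializationAt (EuclideanSpace ℝ (Fin n)) (TangentSpace (𝓡 n)) x).symmₗ ℝ y).comp
      ((trivializationAt (EuclideanSpace ℝ (Fin n)) (TangentSpace (𝓡 n)) x).linearMapAt ℝ x)

theorem chartExt_self {x : M} (v : TangentSpace (𝓡 n) x) : chartExt x v x = v :=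
  (trivializationAt (EuclideanSpace ℝ (Fin n)) (TangentSpace (𝓡 n)) x).symmₗ_linearMapAt
    (FiberBundle.mem_baseSet_trivializationAt' x) v

theorem chartExt_eventuallyEq {x : M} (v : TangentSpace (𝓡 n) x) :
    ∀ᶠ y in nhds x, chartExt x v y = FiberBundle.extend (EuclideanSpace ℝ (Fin n)) v y := by
  filter_upwards [(trivializationAt (EuclideanSpace ℝ (Fin n))
    (TangentSpace (𝓡 n)) x).open_baseSet.mem_nhds
      (FiberBundle.mem_baseSet_trivializationAt' x)] with y hy
  simp only [chartExt, LinearMap.pi_apply, LinearMap.comp_apply, FiberBundle.extend]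
  rw [Bundle.Trivialization.coe_symmₗ _ hy, Bundle.Trivialization.coe_linearMapAt_of_mem _
    (FiberBundle.mem_baseSet_trivializationAt' x)]

theorem mdifferentiableAt_chartExt {x : M} (v : TangentSpace (𝓡 n) x) :
    MDifferentiableAt (𝓡 n) (𝓡 n).tangent
      (fun y => (⟨y, chartExt x v y⟩ : TangentBundle (𝓡 n) M)) x := by
  refine (FiberBundle.mdifferentiableAt_extend (𝓡 n) (EuclideanSpace ℝ (Fin n))
    v).congr_of_eventuallyEq ?_
  filter_upwards [chartExt_eventuallyEq v] with y hy
  rw [hy]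

theorem update_chartExt {p : ℕ} {x : M} (w : Fin p → TangentSpace (𝓡 n) x) (j : Fin p)
    (a : TangentSpace (𝓡 n) x) (y : M) :
    (fun i => chartExt x (Function.update w j a i) y) =
      Function.update (fun i => chartExt x (w i) y) j (chartExt x a y) := by
  funext i
  rcases eq_or_ne i j with rfl | h <;> simp [*]

/-- The `p`-form `φ` is differentiable at `x`: its components with respect to the coordinate vector
fields around `x` are. -/
def PForm.DiffAt {p : ℕ} (φ : PForm n M p) (x : M) : Prop :=
  ∀ w : Fin p → TangentSpace (𝓡 n) x,
    MDifferentiableAt (𝓡 n) 𝓘(ℝ, ℝ) (fun y => φ y (fun i => chartExt x (w i) y)) x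

/-- The derivative at `x` in direction `v` of the components of `φ` with respect to the coordinate
vector fields around `x`. -/
def PForm.compDeriv {p : ℕ} (φ : PForm n M p) {x : M} (hφ : φ.DiffAt x) (v : TangentSpace (𝓡 n) x) :
    TangentSpace (𝓡 n) x [⋀^Fin p]→ₗ[ℝ] ℝ where
  toFun w := mvfderiv (𝓡 n) (fun y => φ y (fun i => chartExt x (w i) y)) x v
  map_update_add' := by
    intro inst w j a b
    obtain rfl : inst = instDecidableEqFin p := Subsingleton.elim _ _
    have h : (fun y => φ y (fun i => chartExt x (Function.update w j (a + b) i) y)) =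
        (fun y => φ y (fun i => chartExt x (Function.update w j a i) y) +
          φ y (fun i => chartExt x (Function.update w j b i) y)) := by
      funext y
      simp only [update_chartExt, map_add, Pi.add_apply, AlternatingMap.map_update_add]
    rw [h, mvfderiv_fun_add (hφ _) (hφ _)]
    rfl
  map_update_smul' := by
    intro inst w j c a
    obtain rfl : inst = instDecidableEqFin p := Subsingleton.elim _ _
    have h : (fun y => φ y (fun i => chartExt x (Function.update w j (c • a) i) y)) =
        (fun y => c * φ y (fun i => chartExt x (Function.update w j a i) y)) := by
      funext y
      simp only [update_chartExt, map_smul, Pi.smul_apply, AlternatingMap.map_update_smul, smul_eq_mul]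
    rw [h, mvfderiv_fun_mul mdifferentiableAt_const (hφ _)]
    simp [mvfderiv_const]
  map_eq_zero_of_eq' := by
    intro w i j hij hne
    have h : (fun y => φ y (fun i => chartExt x (w i) y)) = fun _ => (0 : ℝ) := by
      funext y
      exact (φ y).map_eq_zero_of_eq _ (by simp [hij]) hne
    rw [h, mvfderiv_const]
    rfl

variable (n M) in
/-- Covariant derivatives on the tangent bundle; `nabla Y x v` is `(∇_v Y)(x)`. -/
abbrev Conn : Type _ :=
  CovariantDerivative (𝓡 n) (EuclideanSpace ℝ (Fin n)) (TangentSpace (𝓡 n) : M → Type _)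

/-- The endomorphism `w ↦ ∇_v W` of `T_x M`, where `W` is the extension of `w` that is constant in
the chart at `x`. -/
def connEnd (nabla : Conn n M) {x : M} (v : TangentSpace (𝓡 n) x) :
    TangentSpace (𝓡 n) x →ₗ[ℝ] TangentSpace (𝓡 n) x where
  toFun w := nabla (chartExt x w) x v
  map_add' a b := by
    rw [map_add, nabla.isCovariantDerivativeOn.add (mdifferentiableAt_chartExt a)
      (mdifferentiableAt_chartExt b)]
    rfl
  map_smul' c a := by
    rw [map_smul, nabla.isCovariantDerivativeOn.smul_const c (mdifferentiableAt_chartExt a)]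
    rfl

open Classical in
/-- The induced connection on `p`-forms: for a form `φ` that is differentiable at `x`,
`(∇_v φ)(w_1, …, w_p) = v(φ(W_1, …, W_p)) - ∑ i, φ(w_1, …, ∇_v W_i, …, w_p)`, where `W_i` is any
local extension of `w_i`; the one that is constant in the chart at `x` is used here. -/
def PForm.covDeriv (nabla : Conn n M) {p : ℕ} (φ : PForm n M p) (x : M)
    (v : TangentSpace (𝓡 n) x) : TangentSpace (𝓡 n) x [⋀^Fin p]→ₗ[ℝ] ℝ :=
  if hφ : φ.DiffAt x then φ.compDeriv hφ v - derivationAction (connEnd nabla v) (φ x) else 0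

/-! ### Curvature -/

/-- The curvature of the tangent bundle,
`R(X, Y)Z = ∇_X ∇_Y Z - ∇_Y ∇_X Z - ∇_[X,Y] Z`. -/
def tangentCurvature (nabla : Conn n M) (X Y Z : VField n M) : VField n M := fun x =>
  nabla (fun y => nabla Z y (Y y)) x (X x) - nabla (fun y => nabla Z y (X y)) x (Y x)
    - nabla Z x (mlieBracket (𝓡 n) X Y x)

variable (n M) in
/-- Sections of the exterior bundle `Λ* T*M`, with no regularity imposed. -/
abbrev MixedForm : Type _ := ∀ (x : M) (p : ℕ), TangentSpace (𝓡 n) x [⋀^Fin p]→ₗ[ℝ] ℝ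

/-- The induced connection on the exterior bundle, degree by degree. -/
def MixedForm.covDeriv (nabla : Conn n M) (σ : MixedForm n M) (x : M) (v : TangentSpace (𝓡 n) x) :
    ∀ p : ℕ, TangentSpace (𝓡 n) x [⋀^Fin p]→ₗ[ℝ] ℝ :=
  fun p => PForm.covDeriv nabla (fun y => σ y p) x v

/-- The curvature of the exterior bundle,
`R(X, Y)σ = ∇_X ∇_Y σ - ∇_Y ∇_X σ - ∇_[X,Y] σ`. -/
def exteriorCurvature (nabla : Conn n M) (X Y : VField n M) (σ : MixedForm n M) : MixedForm n M :=
  fun x =>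
    MixedForm.covDeriv nabla (fun y => MixedForm.covDeriv nabla σ y (Y y)) x (X x)
      - MixedForm.covDeriv nabla (fun y => MixedForm.covDeriv nabla σ y (X y)) x (Y x)
      - MixedForm.covDeriv nabla σ x (mlieBracket (𝓡 n) X Y x)

/-- A `p`-form as a section of the exterior bundle. -/
def PForm.toMixed {p : ℕ} (φ : PForm n M p) : MixedForm n M := fun x => Pi.single p (φ x)

section Metric
variable [RiemannianBundle (fun x : M => TangentSpace (𝓡 n) x)]
  [IsContMDiffRiemannianBundle (𝓡 n) ∞ (EuclideanSpace ℝ (Fin n))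
    (fun x : M => TangentSpace (𝓡 n) x)]

set_option synthInstance.maxHeartbeats 400000 in
/-- `nabla` is the Levi-Civita connection of the metric: the torsion-free metric connection. -/
structure IsLeviCivita (nabla : Conn n M) : Prop where
  smooth : CovariantDerivative.ContMDiffCovariantDerivative nabla ∞
  metric : CovariantDerivative.IsMetricCompatible nabla
  torsion_free : CovariantDerivative.torsion nabla = 0

/-- The sectional curvature `⟨R(X, Y)Y, X⟩ / (|X|²|Y|² - ⟨X, Y⟩²)` at `x` of the plane spanned by
`X x` and `Y x`. -/
def sectionalCurvature (nabla : Conn n M) (X Y : VField n M) (x : M) : ℝ :=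
  inner ℝ (tangentCurvature nabla X Y Y x) (X x) /
    (‖X x‖ ^ 2 * ‖Y x‖ ^ 2 - inner ℝ (X x) (Y x) ^ 2)

/-- All sectional curvatures, at all points, are equal to `κ`. -/
def HasConstantSectionalCurvature (nabla : Conn n M) (κ : ℝ) : Prop :=
  ∀ X Y : VField n M, X.SmoothOn Set.univ → Y.SmoothOn Set.univ →
    ∀ x : M, LinearIndependent ℝ ![X x, Y x] → sectionalCurvature nabla X Y x = κ

/-- `e_1, …, e_n` is a smooth orthonormal frame of `TM` on `U`. -/
def IsOrthonormalFrameOn (e : Fin n → VField n M) (U : Set M) : Prop :=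
  (∀ i, (e i).SmoothOn U) ∧ ∀ x ∈ U, Orthonormal ℝ (fun i => e i x)

/-- The Weitzenböck curvature operator of the exterior bundle,
`𝓡σ = ∑_{i<j} e_i · e_j · R(e_i, e_j)σ`, in the frame `e`. -/
def weitzenbock (nabla : Conn n M) (e : Fin n → VField n M) (σ : MixedForm n M) : MixedForm n M :=
  fun x => ∑ i, ∑ j ∈ Finset.Ioi i,
    cliffordAction (V := TangentSpace (𝓡 n) x)
      (CliffordAlgebra.ι (cliffordForm (TangentSpace (𝓡 n) x)) (e i x) *
        CliffordAlgebra.ι (cliffordForm (TangentSpace (𝓡 n) x)) (e j x))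
      (exteriorCurvature nabla (e i) (e j) σ x)

end Metric
end Manifold

end CliffordForms

end

noncomputable section

namespace CliffordForms

/-! At a point, constant sectional curvature forces `R(u, v)w = κ(⟨v, w⟩u - ⟨u, w⟩v)`
(`tangentCurvature_frameExt`, which rests on the polarization in `curvature_eq_of_sectional`). On
forms, curvature acts as minus the derivation induced by this endomorphism
(`covDeriv_commutator_apply`), and the derivation induced by the rank one map `⟨v, ·⟩u` is `v♭ ∧
ι_u` (`derivationEnd_rankOne`).

Write `W i` and `C i` for exterior and interior multiplication by the orthonormal vector `e_i`. Then
`R(e_i, e_j)` acts on forms as `κ(W i C j - W j C i)`, and Clifford multiplication by `e_i` is `W i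
- C i`. The Weitzenböck operator becomes an expression in operators satisfying the canonical
anticommutation relations, and these alone reduce it to `κ(nN - N²)` with the number operator `N = ∑
W i C i` (`sum_Ioi_mul_sub_mul`). Since `N` is the derivation induced by the identity, it is
multiplication by `p` on `p`-forms, which gives `κ p (n - p)`.

The frame and the form are controlled only on `U`, while the curvature lemmas use globally smooth
fields. Bump functions supply global replacements agreeing near the given point, and
`exteriorCurvature_congr` shows that the replacement does not change the curvature there. -/

/-! ### Algebra of the canonical anticommutation relations -/

/-- Summing over all ordered pairs lets the inner sum over `j` be expressed through `N` alone. The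
two halves contribute `nN - N² - N` and `N² - N - nN`, so the linear terms `N` cancel in the
difference. -/
theorem sum_mul_sub_mul {A : Type*} [Ring A] {n : ℕ} (W C : Fin n → A)
    (hWW : ∀ i j, W i * W j = -(W j * W i)) (hW : ∀ i, W i * W i = 0)
    (hCC : ∀ i j, C i * C j = -(C j * C i)) (hC : ∀ i, C i * C i = 0)
    (hCW : ∀ i j, C i * W j = (if i = j then 1 else 0) - W j * C i) :
    ∑ i, ∑ j, (W i - C i) * (W j - C j) * (W i * C j - W j * C i) =
      2 * (n * ∑ i, W i * C i - (∑ i, W i * C i) * ∑ i, W i * C i) := by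
  set N := ∑ i, W i * C i with hN
  have hCWi : ∀ i, C i * W i = 1 - W i * C i := fun i => by simpa using hCW i i
  -- The commutator `[N, C i] = -C i`: contraction lowers the degree by one.
  have hNC : ∀ i, N * C i = C i * N - C i := by
    intro i
    have h : ∀ j, W j * C j * C i = C i * (W j * C j) - (if i = j then C j else 0) := by
      intro j
      have := hCW i j
      rw [← mul_assoc, this, mul_assoc, hCC j i]
      split_ifs <;> noncomm_ring
    rw [hN, Finset.sum_mul, Finset.sum_congr rfl fun j _ => h j, Finset.sum_sub_distrib,
      Finset.mul_sum]
    simp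
  have hsum : ∀ i, ∑ j, (W j - C j) * (W i * C j) = -(W i * N) - C i := by
    intro i
    have h : ∀ j, (W j - C j) * (W i * C j) = -(W i * (W j * C j)) -
        (if j = i then C j else 0) := by
      intro j
      have h1 : (W j - C j) * (W i * C j) = W j * W i * C j - C j * W i * C j := by noncomm_ring
      rw [h1, hWW j i, hCW j i, sub_mul, mul_assoc (W i) (C j), hC]
      split_ifs <;> noncomm_ring
    rw [Finset.sum_congr rfl fun j _ => h j, Finset.sum_sub_distrib, Finset.sum_neg_distrib,
      ← Finset.mul_sum]
    simp [hN]
  have hsum' : ∑ j, (W j - C j) * W j = N - n := by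
    have h : ∀ j, (W j - C j) * W j = W j * C j - 1 := by
      intro j
      rw [sub_mul, hW, hCWi]; abel
    rw [Finset.sum_congr rfl fun j _ => h j, Finset.sum_sub_distrib]
    simp [hN]
  have hcomm : ∀ a : A, (n : A) * a = a * n := fun a => Nat.cast_commute n a
  have h1 : ∑ i, ∑ j, (W i - C i) * (W j - C j) * (W i * C j) = n * N - N * N - N := by
    have h : ∀ i, ∑ j, (W i - C i) * (W j - C j) * (W i * C j) =
        N - W i * C i * N - W i * C i := by
      intro i
      simp only [mul_assoc (W i - C i)]
      rw [← Finset.mul_sum, hsum]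
      have e : (W i - C i) * (-(W i * N) - C i) =
        -(W i * W i * N) - W i * C i + C i * W i * N + C i * C i := by noncomm_ring
      rw [e, hW, hC, hCWi]; noncomm_ring
    rw [Finset.sum_congr rfl fun i _ => h i, Finset.sum_sub_distrib, Finset.sum_sub_distrib,
      ← Finset.sum_mul]
    simp [← hN]
  have h2 : ∑ i, ∑ j, (W i - C i) * (W j - C j) * (W j * C i) = N * N - N - n * N := by
    have h : ∀ i, ∑ j, (W i - C i) * (W j - C j) * (W j * C i) =
        W i * C i * N - W i * C i - n * (W i * C i) := by
      intro i
      have e : ∀ j, (W i - C i) * (W j - C j) * (W j * C i) =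
        (W i - C i) * ((W j - C j) * W j) * C i := fun j => by noncomm_ring
      rw [Finset.sum_congr rfl fun j _ => e j, ← Finset.sum_mul, ← Finset.mul_sum, hsum',
        mul_assoc, sub_mul N, hNC, hcomm, hcomm]
      have e2 : (W i - C i) * (C i * N - C i - C i * n) = W i * C i * N - W i * C i - W i * C i * n
        - (C i * C i) * (N - 1 - n) := by noncomm_ring
      rw [e2, hC]; noncomm_ring
    rw [Finset.sum_congr rfl fun i _ => h i, Finset.sum_sub_distrib, Finset.sum_sub_distrib,
      ← Finset.sum_mul, ← Finset.mul_sum]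
  have h3 : ∀ i j, (W i - C i) * (W j - C j) * (W i * C j - W j * C i) =
      (W i - C i) * (W j - C j) * (W i * C j) - (W i - C i) * (W j - C j) * (W j * C i) :=
    fun i j => mul_sub _ _ _
  simp only [h3, Finset.sum_sub_distrib]
  rw [h1, h2]
  noncomm_ring

theorem two_smul_sum_Ioi {A : Type*} [AddCommGroup A] {n : ℕ} (F : Fin n → Fin n → A)
    (hF : ∀ i j, F i j = F j i) (h0 : ∀ i, F i i = 0) :
    ∑ i, ∑ j, F i j = 2 • ∑ i, ∑ j ∈ Finset.Ioi i, F i j := by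
  have h : ∀ i, ∑ j, F i j = ∑ j ∈ Finset.Ioi i, F i j + ∑ j ∈ Finset.Iio i, F i j := by
    intro i
    rw [← Finset.sum_union, ← Finset.sum_subset (Finset.subset_univ _)]
    · intro j _ hj
      have : j = i := by
        simp at hj; omega
      rw [this, h0]
    · rw [Finset.disjoint_left]; intro j; simp; omega
  have h2 : ∑ i, ∑ j ∈ Finset.Iio i, F i j = ∑ i, ∑ j ∈ Finset.Ioi i, F i j := by
    rw [Finset.sum_comm' (t' := Finset.univ) (s' := fun j => Finset.Ioi j)]
    · exact Finset.sum_congr rfl fun i _ => Finset.sum_congr rfl fun j _ => hF j i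
    · simp
  rw [Finset.sum_congr rfl fun i _ => h i, Finset.sum_add_distrib, h2, two_smul]

/-- For `i ≠ j` the Clifford factors anticommute and the curvature factor is antisymmetric, so the
summand is symmetric in `i, j`; it vanishes on the diagonal. The sum over `i < j` is therefore half
the full sum, and the real scalars allow division by two. -/
theorem sum_Ioi_mul_sub_mul {A : Type*} [Ring A] [Algebra ℝ A] {n : ℕ} (W C : Fin n → A)
    (hWW : ∀ i j, W i * W j = -(W j * W i)) (hW : ∀ i, W i * W i = 0)
    (hCC : ∀ i j, C i * C j = -(C j * C i)) (hC : ∀ i, C i * C i = 0)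
    (hCW : ∀ i j, C i * W j = (if i = j then 1 else 0) - W j * C i) :
    ∑ i, ∑ j ∈ Finset.Ioi i, (W i - C i) * (W j - C j) * (W i * C j - W j * C i) =
      n * ∑ i, W i * C i - (∑ i, W i * C i) * ∑ i, W i * C i := by
  have hmain := sum_mul_sub_mul W C hWW hW hCC hC hCW
  rw [two_smul_sum_Ioi, two_smul, ← two_mul] at hmain
  · have h2 : ∀ a : A, (2 : ℝ) • a = 2 * a := fun a => by rw [two_smul, two_mul]
    rw [← h2, ← h2] at hmain
    exact smul_right_injective A (two_ne_zero (α := ℝ)) hmain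
  · intro i j
    rcases eq_or_ne i j with rfl | hij
    · rfl
    have h1 : (W i - C i) * (W j - C j) = -((W j - C j) * (W i - C i)) := by
      have e1 : (W i - C i) * (W j - C j) = W i * W j - W i * C j - C i * W j + C i * C j := by
        noncomm_ring
      have e2 : (W j - C j) * (W i - C i) = W j * W i - W j * C i - C j * W i + C j * C i := by
        noncomm_ring
      rw [e1, e2, hWW i j, hCC i j, hCW i j, hCW j i, if_neg hij, if_neg hij.symm]
      abel
    rw [h1, neg_mul, ← mul_neg, neg_sub]
  · intro i
    rw [sub_self, mul_zero]

/-! ### Wedge, contraction and derivations on the exterior algebra -/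

section Fiber
variable {V : Type*} [NormedAddCommGroup V] [InnerProductSpace ℝ V]

/-- Exterior multiplication by `v♭` as an endomorphism of the exterior algebra. -/
def wedgeEnd (v : V) : Module.End ℝ (ExteriorForms V) where
  toFun := wedge v
  map_add' α β := by
    funext p; ext w
    rcases p with _ | p <;> simp [wedge, flatWedge_apply, mul_add, Finset.sum_add_distrib]
  map_smul' c α := by
    funext p; ext w
    rcases p with _ | p <;> simp [wedge, flatWedge_apply, Finset.mul_sum, mul_left_comm]

/-- The interior product with `v` as an endomorphism of the exterior algebra. -/
def contractEnd (v : V) : Module.End ℝ (ExteriorForms V) where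
  toFun := contract v
  map_add' α β := by funext p; ext w; simp [contract]
  map_smul' c α := by funext p; ext w; simp [contract]

theorem wedgeEnd_add (u v : V) : wedgeEnd (u + v) = wedgeEnd u + wedgeEnd v := by
  ext1 α; funext p; ext w
  rcases p with _ | p <;>
    simp [wedgeEnd, wedge, flatWedge_apply, inner_add_left, add_mul, mul_add,
      Finset.sum_add_distrib]

theorem contractEnd_add (u v : V) : contractEnd (u + v) = contractEnd u + contractEnd v := by
  ext1 α; funext p; ext w
  simp [contractEnd, contract]

theorem wedgeEnd_mul_self (v : V) : wedgeEnd v * wedgeEnd v = 0 :=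
  LinearMap.ext fun α => wedge_wedge v α

theorem contractEnd_mul_self (v : V) : contractEnd v * contractEnd v = 0 :=
  LinearMap.ext fun α => contract_contract v α

/-- Polarization of the vanishing of squares, applied to `u + v`. -/
theorem wedgeEnd_mul_comm (u v : V) : wedgeEnd u * wedgeEnd v = -(wedgeEnd v * wedgeEnd u) := by
  have h := wedgeEnd_mul_self (u + v)
  rw [wedgeEnd_add, add_mul, mul_add, mul_add, wedgeEnd_mul_self, wedgeEnd_mul_self, zero_add,
    add_zero] at h
  exact LinearMap.ext fun α => eq_neg_of_add_eq_zero_left (LinearMap.congr_fun h α)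

theorem contractEnd_mul_comm (u v : V) :
    contractEnd u * contractEnd v = -(contractEnd v * contractEnd u) := by
  have h := contractEnd_mul_self (u + v)
  rw [contractEnd_add, add_mul, mul_add, mul_add, contractEnd_mul_self, contractEnd_mul_self,
    zero_add, add_zero] at h
  exact LinearMap.ext fun α => eq_neg_of_add_eq_zero_left (LinearMap.congr_fun h α)

/-- In the expansion of `v♭ ∧ α` evaluated with `u` in the first slot, the term omitting that slot
yields `⟨u, v⟩α`. Every other term has its sign shifted by one position and assembles to `-v♭ ∧ ι_u
α`. -/
theorem contractEnd_mul_wedgeEnd (u v : V) :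
    contractEnd u * wedgeEnd v = (inner ℝ u v : ℝ) • 1 - wedgeEnd v * contractEnd u := by
  ext1 α
  funext p; ext w
  rcases p with _ | p
  · simp [contractEnd, wedgeEnd, contract, wedge, flatWedge_apply, real_inner_comm]
  · simp [contractEnd, wedgeEnd, contract, wedge, flatWedge_apply, Fin.sum_univ_succ (n := p + 1),
      real_inner_comm]
    rw [sub_eq_add_neg, ← Finset.sum_neg_distrib]
    congr 1
    refine Finset.sum_congr rfl fun i _ => ?_
    have h : i.succ.removeNth (Matrix.vecCons u w : Fin (p + 2) → V) =
        Matrix.vecCons u (i.removeNth w) := by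
      funext j
      refine Fin.cases ?_ (fun k => ?_) j <;> simp [Fin.removeNth]
    rw [h]
    ring

theorem cliffordAction_ι_mul_ι (u v : V) :
    cliffordAction (CliffordAlgebra.ι (cliffordForm V) u * CliffordAlgebra.ι (cliffordForm V) v) =
      (wedgeEnd u - contractEnd u) * (wedgeEnd v - contractEnd v) := by
  rw [map_mul, cliffordAction, CliffordAlgebra.lift_ι_apply, CliffordAlgebra.lift_ι_apply]
  rfl

/-- The derivation of the exterior algebra induced by an endomorphism of `V`. -/
def derivationEnd (A : V →ₗ[ℝ] V) : Module.End ℝ (ExteriorForms V) where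
  toFun α := fun p => derivationAction A (α p)
  map_add' α β := by
    funext p; ext w; simp [derivationAction, Finset.sum_add_distrib]
  map_smul' c α := by
    funext p; ext w; simp [derivationAction, Finset.mul_sum]

/-- The rank one endomorphism `w ↦ ⟨v, w⟩ u`. -/
def rankOne (v u : V) : V →ₗ[ℝ] V := (innerₗ V v).smulRight u

/-- Replacing `w i` by `⟨v, w i⟩u` and moving `u` to the front costs `(-1)^i`, exactly the sign in
the expansion of the wedge with `v♭`. -/
theorem derivationEnd_rankOne (v u : V) :
    derivationEnd (rankOne v u) = wedgeEnd v * contractEnd u := by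
  ext1 α
  funext p; ext w
  rcases p with _ | p
  · simp [derivationEnd, derivationAction, wedgeEnd, wedge]
  · simp only [derivationEnd, derivationAction, wedgeEnd, wedge, rankOne, contractEnd, contract,
      Module.End.mul_apply, LinearMap.coe_mk, AddHom.coe_mk, flatWedge_apply,
      AlternatingMap.coe_mk, MultilinearMap.coe_mk]
    refine Finset.sum_congr rfl fun i _ => ?_
    have h : Function.update w i u = i.insertNth u (i.removeNth w) := by
      simp
    rw [LinearMap.smulRight_apply, AlternatingMap.map_update_smul, h,
      AlternatingMap.map_insertNth]
    simp [mul_left_comm, Matrix.vecCons]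

theorem derivationEnd_sub (A B : V →ₗ[ℝ] V) :
    derivationEnd (A - B) = derivationEnd A - derivationEnd B := by
  ext1 α
  funext p; ext w
  simp [derivationEnd, derivationAction, Finset.sum_sub_distrib]

theorem derivationEnd_smul (c : ℝ) (A : V →ₗ[ℝ] V) :
    derivationEnd (c • A) = c • derivationEnd A := by
  ext1 α
  funext p; ext w
  simp [derivationEnd, derivationAction, Finset.mul_sum]

theorem derivationEnd_sum {ι : Type*} (s : Finset ι) (A : ι → V →ₗ[ℝ] V) :
    derivationEnd (∑ i ∈ s, A i) = ∑ i ∈ s, derivationEnd (A i) := by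
  classical
  induction s using Finset.induction_on with
  | empty =>
    ext1 α
    funext p; ext w
    simp [derivationEnd, derivationAction]
  | insert a s ha ih =>
    rw [Finset.sum_insert ha, Finset.sum_insert ha, ← ih]
    ext1 α
    funext p; ext w
    simp [derivationEnd, derivationAction, Finset.sum_add_distrib]

theorem derivationEnd_one_apply (α : ExteriorForms V) (p : ℕ) :
    derivationEnd (LinearMap.id : V →ₗ[ℝ] V) α p = (p : ℝ) • α p := by
  ext w
  simp [derivationEnd, derivationAction]


/-- The curvature endomorphism `w ↦ κ (⟨v, w⟩ u - ⟨u, w⟩ v)` of a space of constant sectional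
curvature `κ`. -/
def constCurvEnd (κ : ℝ) (u v : V) : V →ₗ[ℝ] V := κ • (rankOne v u - rankOne u v)

theorem constCurvEnd_apply (κ : ℝ) (u v w : V) :
    constCurvEnd κ u v w = κ • ((inner ℝ v w : ℝ) • u - (inner ℝ u w : ℝ) • v) := rfl

/-- The rank one projections onto the vectors of an orthonormal basis sum to the identity. -/
theorem sum_wedgeEnd_mul_contractEnd {n : ℕ} (b : OrthonormalBasis (Fin n) ℝ V) :
    ∑ i, wedgeEnd (b i) * contractEnd (b i) = derivationEnd (LinearMap.id : V →ₗ[ℝ] V) := by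
  simp only [← derivationEnd_rankOne]
  rw [← derivationEnd_sum]
  congr 1
  ext w
  simpa [rankOne] using b.sum_repr' w

theorem sum_cliffordAction_derivationEnd {n : ℕ} (b : OrthonormalBasis (Fin n) ℝ V) (κ : ℝ)
    (α : ExteriorForms V) :
    ∑ i, ∑ j ∈ Finset.Ioi i,
      cliffordAction (CliffordAlgebra.ι (cliffordForm V) (b i) *
        CliffordAlgebra.ι (cliffordForm V) (b j))
        (-derivationEnd (constCurvEnd κ (b i) (b j)) α) =
      fun p : ℕ => (κ * p * ((n : ℝ) - p)) • α p := by
  set W : Fin n → Module.End ℝ (ExteriorForms V) := fun i => wedgeEnd (b i) with hW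
  set C : Fin n → Module.End ℝ (ExteriorForms V) := fun i => contractEnd (b i) with hC
  have hCW : ∀ i j, C i * W j = (if i = j then 1 else 0) - W j * C i := by
    intro i j
    simp only [hW, hC, contractEnd_mul_wedgeEnd, orthonormal_iff_ite.mp b.orthonormal]
    split_ifs <;> simp
  have hWW : ∀ i j, W i * W j = -(W j * W i) := fun i j => wedgeEnd_mul_comm _ _
  have hCC : ∀ i j, C i * C j = -(C j * C i) := fun i j => contractEnd_mul_comm _ _
  have hmain := sum_Ioi_mul_sub_mul W C hWW (fun i => wedgeEnd_mul_self _) hCC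
    (fun i => contractEnd_mul_self _) hCW
  have hN : ∑ i, W i * C i = derivationEnd (LinearMap.id : V →ₗ[ℝ] V) :=
    sum_wedgeEnd_mul_contractEnd b
  have hterm : ∀ i j, cliffordAction (CliffordAlgebra.ι (cliffordForm V) (b i) *
        CliffordAlgebra.ι (cliffordForm V) (b j))
        (-derivationEnd (constCurvEnd κ (b i) (b j)) α) =
      κ • ((W i - C i) * (W j - C j) * (W i * C j - W j * C i)) α := by
    intro i j
    have h : -derivationEnd (constCurvEnd κ (b i) (b j)) α =
        κ • (W i * C j - W j * C i) α := by
      rw [constCurvEnd, derivationEnd_smul, derivationEnd_sub, derivationEnd_rankOne,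
        derivationEnd_rankOne, LinearMap.smul_apply, ← smul_neg, LinearMap.sub_apply,
        LinearMap.sub_apply, neg_sub]
    rw [h, map_smul, cliffordAction_ι_mul_ι]
    rfl
  simp only [hterm, ← Finset.smul_sum]
  have happly := LinearMap.congr_fun hmain α
  simp only [LinearMap.sum_apply] at happly
  rw [happly, hN]
  funext p
  ext w
  have hn : ((n : Module.End ℝ (ExteriorForms V))) = (n : ℝ) • 1 := by
    rw [Nat.cast_smul_eq_nsmul, nsmul_one]
  simp only [hn, LinearMap.sub_apply, Module.End.mul_apply, LinearMap.smul_apply, Pi.smul_apply,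
    Pi.sub_apply, derivationEnd_one_apply, Module.End.one_apply, AlternatingMap.smul_apply,
    AlternatingMap.sub_apply, smul_eq_mul]
  ring

end Fiber

/-! ### Algebraic curvature tensors -/

/-- A quadrilinear form with the symmetries of a curvature tensor and vanishing sectional
curvatures is zero. -/
theorem eq_zero_of_curvature_symmetries {V : Type*} [AddCommGroup V] (D : V → V → V → V → ℝ)
    (h2 : ∀ a b b' c d, D a (b + b') c d = D a b c d + D a b' c d)
    (h4 : ∀ a b c d d', D a b c (d + d') = D a b c d + D a b c d')
    (h12 : ∀ a b c d, D a b c d = -D b a c d) (h34 : ∀ a b c d, D a b c d = -D a b d c)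
    (hB : ∀ a b c d, D a b c d + D b c a d + D c a b d = 0) (hs : ∀ a b, D a b b a = 0)
    (a b c d : V) : D a b c d = 0 := by
  have h3 : ∀ a b c c' d, D a b (c + c') d = D a b c d + D a b c' d := by
    intro a b c c' d
    rw [h34, h4, h34 a b c d, h34 a b c' d]; ring
  have h1 : ∀ a a' b c d, D (a + a') b c d = D a b c d + D a' b c d := by
    intro a a' b c d
    rw [h12, h2, h12 a b c d, h12 a' b c d]; ring
  -- The classical pair symmetry, from four instances of the Bianchi identity and the two
  -- antisymmetries.
  have hpair : ∀ a b c d, D a b c d = D c d a b := by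
    intro a b c d
    linarith [hB a b c d, hB b c d a, hB c d a b, hB d a b c, h12 a b c d, h34 a b c d,
      h12 b c a d, h34 b c a d, h12 c a b d, h34 c a b d, h12 b c d a, h12 c d b a, h34 c d b a,
      h12 d b c a, h34 d b c a, h12 c d a b, h34 c d a b, h12 d a c b, h34 d a c b, h12 a c d b,
      h34 a c d b, h12 d a b c, h34 d a b c, h12 a b d c, h34 a b d c, h12 b d a c, h34 b d a c]
  -- Polarize `D a b b a = 0` in `b`; pair symmetry makes the two cross terms equal.
  have h14 : ∀ a b c, D a b c a = 0 := by
    intro a b c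
    have h := hs a (b + c)
    rw [h2, h3, h3, hs, hs] at h
    have e : D a c b a = D a b c a := by
      rw [hpair, h12, h34]; ring
    linarith
  have h14' : ∀ a b c d, D a b c d = -D d b c a := by
    intro a b c d
    have h := h14 (a + d) b c
    rw [h1, h4, h4, h14, h14] at h
    linarith
  have h23 : ∀ a b c d, D a b c d = -D a c b d := by
    intro a b c d
    rw [h12 a b c d, h34 b a c d, h14' b a d c, h12 c a d b, h34 a c d b]; ring
  -- `D` is now antisymmetric under adjacent transpositions, hence invariant under 3-cycles, so the
  -- Bianchi identity reads `3D = 0`.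
  have hcyc : ∀ a b c d, D b c a d = D a b c d := by
    intro a b c d
    rw [h23 b c a d, h12 b a c d]; ring
  linarith [hB a b c d, hcyc a b c d, hcyc b c a d]

/-- A curvature tensor with constant sectional curvature `κ`. -/
theorem curvature_eq_of_sectional {V : Type*} [NormedAddCommGroup V] [InnerProductSpace ℝ V]
    (R : V → V → V → V → ℝ) (κ : ℝ)
    (h2 : ∀ a b b' c d, R a (b + b') c d = R a b c d + R a b' c d)
    (h4 : ∀ a b c d d', R a b c (d + d') = R a b c d + R a b c d')
    (h12 : ∀ a b c d, R a b c d = -R b a c d) (h34 : ∀ a b c d, R a b c d = -R a b d c)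
    (hB : ∀ a b c d, R a b c d + R b c a d + R c a b d = 0)
    (hs : ∀ a b, R a b b a = κ * (‖a‖ ^ 2 * ‖b‖ ^ 2 - inner ℝ a b ^ 2)) (a b c d : V) :
    R a b c d = κ * (inner ℝ b c * inner ℝ a d - inner ℝ a c * inner ℝ b d) := by
  rw [← sub_eq_zero]
  refine eq_zero_of_curvature_symmetries
    (fun a b c d => R a b c d - κ * (inner ℝ b c * inner ℝ a d - inner ℝ a c * inner ℝ b d))
    ?_ ?_ ?_ ?_ ?_ ?_ a b c d
  · intro a b b' c d
    simp only [h2, inner_add_left]; ring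
  · intro a b c d d'
    simp only [h4, inner_add_right]; ring
  · intro a b c d
    simp only [h12 a b c d]; ring
  · intro a b c d
    simp only [h34 a b c d]; ring
  · intro a b c d
    have := hB a b c d
    simp only [real_inner_comm a c, real_inner_comm b c, real_inner_comm a b]
    linarith
  · intro a b
    simp only [hs, real_inner_self_eq_norm_sq, real_inner_comm a b]; ring


/-! ### Smooth vector fields, extensions and Lie brackets -/

section Manifold

variable {n : ℕ} {M : Type*} [TopologicalSpace M] [ChartedSpace (EuclideanSpace ℝ (Fin n)) M]
  [IsManifold (𝓡 n) ∞ M]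

/-- The vector field `X` is smooth on `M`. -/
def VField.Smooth (X : VField n M) : Prop :=
  ContMDiff (𝓡 n) (𝓡 n).tangent ∞ (fun y => (⟨y, X y⟩ : TangentBundle (𝓡 n) M))

namespace VField.Smooth

theorem mdifferentiableAt {X : VField n M} (hX : X.Smooth) (x : M) :
    MDifferentiableAt (𝓡 n) (𝓡 n).tangent (fun y => (⟨y, X y⟩ : TangentBundle (𝓡 n) M)) x :=
  (hX x).mdifferentiableAt (by simp)

theorem smoothOn {X : VField n M} (hX : X.Smooth) : X.SmoothOn Set.univ := hX.contMDiffOn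

theorem add {X Y : VField n M} (hX : X.Smooth) (hY : Y.Smooth) : VField.Smooth (X + Y) :=
  ContMDiff.add_section hX hY

theorem sub {X Y : VField n M} (hX : X.Smooth) (hY : Y.Smooth) : VField.Smooth (X - Y) :=
  ContMDiff.sub_section hX hY

theorem fun_smul {f : M → ℝ} {X : VField n M} (hf : ContMDiff (𝓡 n) 𝓘(ℝ, ℝ) ∞ f) (hX : X.Smooth) :
    VField.Smooth (f • X) :=
  ContMDiff.smul_section hf hX

theorem const_smul (c : ℝ) {X : VField n M} (hX : X.Smooth) : VField.Smooth (c • X) :=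
  ContMDiff.const_smul_section hX

theorem nabla {nabla : Conn n M}
    (h : CovariantDerivative.ContMDiffCovariantDerivative nabla ∞) {X Y : VField n M}
    (hX : X.Smooth) (hY : Y.Smooth) : VField.Smooth (fun y => nabla Y y (X y)) := by
  intro x
  have := (h.contMDiff.contMDiff (σ := Y) hY.contMDiffOn).contMDiffAt (x := x) Filter.univ_mem
  exact ContMDiffAt.clm_bundle_apply (E₁ := (TangentSpace (𝓡 n) : M → Type _))
    (E₂ := (TangentSpace (𝓡 n) : M → Type _)) this (hX x)

end VField.Smooth

theorem contMDiff_mvfderiv {f : M → ℝ} {X : VField n M} (hf : ContMDiff (𝓡 n) 𝓘(ℝ, ℝ) ∞ f)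
    (hX : X.Smooth) : ContMDiff (𝓡 n) 𝓘(ℝ, ℝ) ∞ (fun y => mvfderiv (𝓡 n) f y (X y)) := by
  have h := (hf.contMDiff_tangentMap (m := ∞) le_rfl).comp hX
  intro x
  have h2 := (contMDiffAt_totalSpace.mp (h x)).2
  simp [tangentMap] at h2
  exact h2

theorem exists_smooth_extension [T2Space M] {U : Set M} (hU : IsOpen U) {X : VField n M}
    (hX : X.SmoothOn U) {x : M} (hx : x ∈ U) :
    ∃ X' : VField n M, X'.Smooth ∧ X' =ᶠ[nhds x] X := by
  obtain ⟨χ, hχ⟩ :=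
    (SmoothBumpFunction.nhds_basis_tsupport (I := 𝓡 n) x).mem_iff.mp (hU.mem_nhds hx)
  refine ⟨(χ : M → ℝ) • X, ?_, ?_⟩
  · exact ContMDiffOn.smul_section_of_tsupport χ.contMDiff.contMDiffOn hU hχ.2 hX
  · filter_upwards [χ.eventuallyEq_one] with y hy
    change χ y • X y = X y
    rw [hy]
    exact one_smul ℝ (X y)

theorem exists_smooth_eventuallyEq_chartExt [T2Space M] {x : M} (v : TangentSpace (𝓡 n) x) :
    ∃ X : VField n M, X.Smooth ∧ X =ᶠ[nhds x] chartExt x v := by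
  obtain ⟨s, hs, h⟩ := FiberBundle.exists_contMDiffOn_extend (k := ∞) (𝓡 n)
    (EuclideanSpace ℝ (Fin n)) v
  obtain ⟨X, hX, hX'⟩ := exists_smooth_extension isOpen_interior (h.mono interior_subset)
    (mem_interior_iff_mem_nhds.mpr hs)
  refine ⟨X, hX, ?_⟩
  filter_upwards [hX', chartExt_eventuallyEq v] with y h1 h2
  rw [h1, h2]

theorem exists_smooth_apply_eq [T2Space M] {x : M} (v : TangentSpace (𝓡 n) x) :
    ∃ X : VField n M, X.Smooth ∧ X x = v := by
  obtain ⟨X, hX, hX'⟩ := exists_smooth_eventuallyEq_chartExt v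
  exact ⟨X, hX, hX'.self_of_nhds.trans (chartExt_self v)⟩

theorem mlieBracket_eq {nabla : Conn n M} (ht : CovariantDerivative.torsion nabla = 0)
    {X Y : VField n M} (hX : X.Smooth) (hY : Y.Smooth) (x : M) :
    mlieBracket (𝓡 n) X Y x = nabla Y x (X x) - nabla X x (Y x) :=
  ((CovariantDerivative.torsion_eq_zero_iff nabla).mp ht (hX.mdifferentiableAt x)
    (hY.mdifferentiableAt x)).symm

theorem VField.Smooth.mlieBracket {X Y : VField n M} (hX : X.Smooth) (hY : Y.Smooth) :
    VField.Smooth (VectorField.mlieBracket (𝓡 n) X Y) :=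
  haveI : IsManifold (𝓡 n) (minSmoothness ℝ 2) M := by
    rw [minSmoothness_of_isRCLikeNormedField]; infer_instance
  haveI : IsManifold (𝓡 n) ((⊤ : ℕ∞) + 1) M := inferInstanceAs (IsManifold (𝓡 n) ∞ M)
  ContDiff.mlieBracket_vectorField (m := ⊤) (n := ⊤) hX hY (by simp)

theorem jacobi {X Y Z : VField n M} (hX : X.Smooth) (hY : Y.Smooth) (hZ : Z.Smooth) (x : M) :
    VectorField.mlieBracket (𝓡 n) X (VectorField.mlieBracket (𝓡 n) Y Z) x =
      VectorField.mlieBracket (𝓡 n) (VectorField.mlieBracket (𝓡 n) X Y) Z x +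
        VectorField.mlieBracket (𝓡 n) Y (VectorField.mlieBracket (𝓡 n) X Z) x :=
  haveI : IsManifold (𝓡 n) (minSmoothness ℝ 3) M := by
    rw [minSmoothness_of_isRCLikeNormedField]; infer_instance
  have h2 : minSmoothness ℝ 2 ≤ (∞ : WithTop ℕ∞) := by
    rw [minSmoothness_of_isRCLikeNormedField]; exact ENat.LEInfty.out
  leibniz_identity_mlieBracket_apply ((hX x).of_le h2) ((hY x).of_le h2)
    ((hZ x).of_le h2)

/-- `[X, Y]f = X(Yf) - Y(Xf)`. -/
theorem mvfderiv_mlieBracket [T2Space M] {f : M → ℝ} (hf : ContMDiff (𝓡 n) 𝓘(ℝ, ℝ) ∞ f)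
    {X Y : VField n M} (hX : X.Smooth) (hY : Y.Smooth) (x : M) :
    mvfderiv (𝓡 n) f x (VectorField.mlieBracket (𝓡 n) X Y x) =
      mvfderiv (𝓡 n) (fun y => mvfderiv (𝓡 n) f y (Y y)) x (X x) -
        mvfderiv (𝓡 n) (fun y => mvfderiv (𝓡 n) f y (X y)) x (Y x) := by
  -- The identity is extracted as a coefficient of a test field `Z` with `Z x ≠ 0`, so a zero
  -- tangent space is treated separately.
  by_cases htriv : ∀ v : TangentSpace (𝓡 n) x, v = 0
  · rw [htriv (VectorField.mlieBracket (𝓡 n) X Y x), htriv (X x), htriv (Y x)]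
    simp
  push Not at htriv
  obtain ⟨v, hv⟩ := htriv
  obtain ⟨Z, hZ, rfl⟩ := exists_smooth_apply_eq v
  have hbr : ∀ {A : VField n M}, A.Smooth →
      VectorField.mlieBracket (𝓡 n) A (f • Z) =
        (fun y => mvfderiv (𝓡 n) f y (A y)) • Z + f • VectorField.mlieBracket (𝓡 n) A Z := by
    intro A hA
    funext y
    exact mlieBracket_smul_right ((hf y).mdifferentiableAt (by simp)) (hZ.mdifferentiableAt y)
  have hbr2 : ∀ {A B : VField n M}, A.Smooth → B.Smooth →
      VectorField.mlieBracket (𝓡 n) A (VectorField.mlieBracket (𝓡 n) B (f • Z)) x =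
        (mvfderiv (𝓡 n) (fun y => mvfderiv (𝓡 n) f y (B y)) x (A x)) • Z x +
        mvfderiv (𝓡 n) f x (B x) • VectorField.mlieBracket (𝓡 n) A Z x +
        (mvfderiv (𝓡 n) f x (A x) • VectorField.mlieBracket (𝓡 n) B Z x +
        f x • VectorField.mlieBracket (𝓡 n) A (VectorField.mlieBracket (𝓡 n) B Z) x) := by
    intro A B hA hB
    have hfB := contMDiff_mvfderiv hf hB
    rw [hbr hB, mlieBracket_add_right ((VField.Smooth.fun_smul hfB hZ).mdifferentiableAt x)
      ((VField.Smooth.fun_smul hf (hB.mlieBracket hZ)).mdifferentiableAt x),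
      mlieBracket_smul_right ((hfB x).mdifferentiableAt (by simp)) (hZ.mdifferentiableAt x),
      mlieBracket_smul_right ((hf x).mdifferentiableAt (by simp))
        ((hB.mlieBracket hZ).mdifferentiableAt x)]
  -- In the Jacobi identity for `X`, `Y`, `fZ` the mixed first-order terms cancel, and the terms
  -- multiplied by `f` cancel by Jacobi for `X`, `Y`, `Z`. Only derivatives of `f` times `Z x`
  -- remain.
  have h := jacobi hX hY (VField.Smooth.fun_smul hf hZ) x
  rw [hbr2 hX hY, hbr2 hY hX, hbr (hX.mlieBracket hY), jacobi hX hY hZ x] at h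
  have h0 : (mvfderiv (𝓡 n) f x (VectorField.mlieBracket (𝓡 n) X Y x) -
      (mvfderiv (𝓡 n) (fun y => mvfderiv (𝓡 n) f y (Y y)) x (X x) -
        mvfderiv (𝓡 n) (fun y => mvfderiv (𝓡 n) f y (X y)) x (Y x))) • Z x = 0 := by
    simp only [Pi.add_apply, Pi.smul_apply'] at h
    rw [← sub_eq_zero] at h
    rw [← neg_eq_zero, ← h]
    module
  exact sub_eq_zero.mp ((smul_eq_zero.mp h0).resolve_right hv)

end Manifold

/-! ### The Leibniz formula with arbitrary extensions -/

theorem update_eval {ι X : Type*} [DecidableEq ι] {F : X → Type*} (V : ι → ∀ x, F x) (i : ι)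
    (σ : ∀ x, F x) (y : X) :
    (fun k => Function.update V i σ k y) = Function.update (fun k => V k y) i (σ y) := by
  funext k
  rcases eq_or_ne k i with rfl | h <;> simp [*]

section Manifold

variable {n : ℕ} {M : Type*} [TopologicalSpace M] [ChartedSpace (EuclideanSpace ℝ (Fin n)) M]
  [IsManifold (𝓡 n) ∞ M]

/-- The local frame of the trivialization at `x` consists, near `x`, of the chart-constant
extensions of its own values at `x`. -/
theorem exists_eventually_eq_sum_chartExt {σ : VField n M} {x : M}
    (hσ : MDifferentiableAt (𝓡 n) (𝓡 n).tangent (fun y => (⟨y, σ y⟩ : TangentBundle (𝓡 n) M)) x) :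
    ∃ (c : Fin n → M → ℝ) (v : Fin n → TangentSpace (𝓡 n) x),
      (∀ j, MDifferentiableAt (𝓡 n) 𝓘(ℝ, ℝ) (c j) x) ∧
      ∀ᶠ y in nhds x, σ y = ∑ j, c j y • chartExt x (v j) y := by
  set t := trivializationAt (EuclideanSpace ℝ (Fin n)) (TangentSpace (𝓡 n) : M → Type _) x with ht
  have hx : x ∈ t.baseSet := FiberBundle.mem_baseSet_trivializationAt' x
  set b := (EuclideanSpace.basisFun (Fin n) ℝ).toBasis
  refine ⟨fun j y => t.localFrameCoeff (𝓡 n) b j y (σ y), fun j => t.localFrame b j x,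
    fun j => mdifferentiableAt_localFrameCoeff b hx hσ j, ?_⟩
  filter_upwards [t.eventually_eq_localFrame_sum_coeff_smul (I := 𝓡 n) (s := σ) b hx,
    t.open_baseSet.mem_nhds hx] with y hy hyt
  rw [hy]
  refine Finset.sum_congr rfl fun j _ => ?_
  rw [← hy]
  congr 1
  rw [t.localFrame_apply_of_mem_baseSet b hx, t.localFrame_apply_of_mem_baseSet b hyt]
  simp only [chartExt, LinearMap.pi_apply, LinearMap.comp_apply, ← ht]
  simp [Trivialization.basisAt, hx, hyt]

/-- `DiffAt` tests chart-constant fields only. They are exchanged for the `W i` one slot at a time,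
expanding each `W i` in chart-constant fields with differentiable coefficients. -/
theorem PForm.DiffAt.mdifferentiableAt_apply {p : ℕ} {φ : PForm n M p} {x : M} (hφ : φ.DiffAt x)
    {W : Fin p → VField n M}
    (hW : ∀ i, MDifferentiableAt (𝓡 n) (𝓡 n).tangent
      (fun y => (⟨y, W i y⟩ : TangentBundle (𝓡 n) M)) x) :
    MDifferentiableAt (𝓡 n) 𝓘(ℝ, ℝ) (fun y => φ y (fun i => W i y)) x := by
  -- The quantification over `w` is essential: expanding slot `j` inserts new frame vectors there
  -- before the induction hypothesis is used.
  have key : ∀ (s : Finset (Fin p)) (w : Fin p → TangentSpace (𝓡 n) x),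
      MDifferentiableAt (𝓡 n) 𝓘(ℝ, ℝ)
        (fun y => φ y (fun i => s.piecewise W (fun i => chartExt x (w i)) i y)) x := by
    intro s
    induction s using Finset.induction_on with
    | empty => exact fun w => by simpa using hφ w
    | insert j s hj ih =>
      intro w
      obtain ⟨c, v, hc, hv⟩ := exists_eventually_eq_sum_chartExt (hW j)
      have hpw : ∀ k, (fun i => chartExt x (Function.update w j (v k) i)) =
          Function.update (fun i => chartExt x (w i)) j (chartExt x (v k)) := by
        intro k
        funext i
        rcases eq_or_ne i j with rfl | h <;> simp [*]
      have h1 : MDifferentiableAt (𝓡 n) 𝓘(ℝ, ℝ) (fun y => ∑ k, c k y *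
          φ y (fun i => s.piecewise W (fun i => chartExt x (Function.update w j (v k) i)) i y)) x := by
        convert! MDifferentiableAt.sum (t := Finset.univ)
          fun k _ => (hc k).mul (ih (Function.update w j (v k))) using 1
        funext y
        simp
      refine h1.congr_of_eventuallyEq ?_
      filter_upwards [hv] with y hy
      rw [Finset.piecewise_insert, update_eval, hy, AlternatingMap.map_update_sum]
      refine Finset.sum_congr rfl fun k _ => ?_
      rw [AlternatingMap.map_update_smul, smul_eq_mul, hpw,
        ← Finset.update_piecewise_of_notMem _ _ _ hj, update_eval]
  simpa using key Finset.univ (fun i => W i x)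

/-- The Leibniz expression `v(φ(W_1, …, W_p)) - ∑ i, φ(W_1, …, ∇_v W_i, …, W_p)`. -/
def leibnizExpr (nabla : Conn n M) {p : ℕ} (φ : PForm n M p) (x : M) (v : TangentSpace (𝓡 n) x)
    (W : Fin p → VField n M) : ℝ :=
  mvfderiv (𝓡 n) (fun y => φ y (fun i => W i y)) x v -
    ∑ i, φ x (Function.update (fun i => W i x) i (nabla (W i) x v))

/-- If slot `i` is multiplied by `f`, differentiating the function and differentiating the field
produce the same term in `df(v)`, with opposite signs. -/
theorem tensorialAt_leibnizExpr (nabla : Conn n M) {p : ℕ} {φ : PForm n M p} {x : M}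
    (hφ : φ.DiffAt x) (v : TangentSpace (𝓡 n) x) {V : Fin p → VField n M}
    (hV : ∀ i, MDifferentiableAt (𝓡 n) (𝓡 n).tangent
      (fun y => (⟨y, V i y⟩ : TangentBundle (𝓡 n) M)) x) (i : Fin p) :
    TensorialAt (𝓡 n) (EuclideanSpace ℝ (Fin n))
      (fun σ : VField n M => leibnizExpr nabla φ x v (Function.update V i σ)) x := by
  have hdiff : ∀ {σ : VField n M}, MDifferentiableAt (𝓡 n) (𝓡 n).tangent
      (fun y => (⟨y, σ y⟩ : TangentBundle (𝓡 n) M)) x →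
      MDifferentiableAt (𝓡 n) 𝓘(ℝ, ℝ)
        (fun y => φ y (Function.update (fun k => V k y) i (σ y))) x := by
    intro σ hσ
    have h := hφ.mdifferentiableAt_apply (W := Function.update V i σ) (by
      intro k
      rcases eq_or_ne k i with rfl | h
      · simpa using hσ
      · simpa [h] using hV k)
    simpa only [update_eval] using h
  constructor
  · intro f σ hf hσ
    have hsum : ∀ k, φ x (Function.update (Function.update (fun k => V k x) i ((f • σ) x)) k
        (nabla (Function.update V i (f • σ) k) x v)) =
        f x * φ x (Function.update (Function.update (fun k => V k x) i (σ x)) k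
        (nabla (Function.update V i σ k) x v)) +
        if k = i then mvfderiv (𝓡 n) f x v * φ x (Function.update (fun k => V k x) i (σ x)) else 0 := by
      intro k
      rcases eq_or_ne k i with rfl | h
      · simp only [Function.update_self, Function.update_idem, if_true,
          nabla.isCovariantDerivativeOn.leibniz hσ hf]
        simp
      · simp only [Function.update_of_ne h, if_neg h, add_zero, Function.update_comm h.symm]
        simp
    have hfun : (fun y => φ y (Function.update (fun k => V k y) i ((f • σ) y))) =
        fun y => f y * φ y (Function.update (fun k => V k y) i (σ y)) := by
      funext y
      simp
    simp only [leibnizExpr, update_eval]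
    rw [Finset.sum_congr rfl fun k _ => hsum k, Finset.sum_add_distrib, ← Finset.mul_sum, hfun,
      mvfderiv_fun_mul hf (hdiff hσ)]
    simp
    ring
  · intro σ σ' hσ hσ'
    have hsum : ∀ k, φ x (Function.update (Function.update (fun k => V k x) i ((σ + σ') x)) k
        (nabla (Function.update V i (σ + σ') k) x v)) =
        φ x (Function.update (Function.update (fun k => V k x) i (σ x)) k
        (nabla (Function.update V i σ k) x v)) +
        φ x (Function.update (Function.update (fun k => V k x) i (σ' x)) k
        (nabla (Function.update V i σ' k) x v)) := by
      intro k
      rcases eq_or_ne k i with rfl | h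
      · simp only [Function.update_self, Function.update_idem,
          nabla.isCovariantDerivativeOn.add hσ hσ']
        simp
      · simp only [Function.update_of_ne h, Function.update_comm h.symm]
        simp
    have hfun : (fun y => φ y (Function.update (fun k => V k y) i ((σ + σ') y))) =
        fun y => φ y (Function.update (fun k => V k y) i (σ y)) +
          φ y (Function.update (fun k => V k y) i (σ' y)) := by
      funext y
      simp
    simp only [leibnizExpr, update_eval]
    rw [Finset.sum_congr rfl fun k _ => hsum k, Finset.sum_add_distrib, hfun,
      mvfderiv_fun_add (hdiff hσ) (hdiff hσ')]
    simp
    ring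

/-- Tensoriality makes the Leibniz expression depend only on the values at `x`, so the
chart-constant extensions in the definition of `covDeriv` can be exchanged for `W` slot by slot. -/
theorem covDeriv_apply (nabla : Conn n M) {p : ℕ} {φ : PForm n M p} {x : M}
    (hφ : φ.DiffAt x) (v : TangentSpace (𝓡 n) x) {W : Fin p → VField n M}
    (hW : ∀ i, MDifferentiableAt (𝓡 n) (𝓡 n).tangent
      (fun y => (⟨y, W i y⟩ : TangentBundle (𝓡 n) M)) x) :
    φ.covDeriv nabla x v (fun i => W i x) = leibnizExpr nabla φ x v W := by
  set E : Fin p → VField n M := fun i => chartExt x (W i x) with hE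
  have hEd : ∀ i, MDifferentiableAt (𝓡 n) (𝓡 n).tangent
      (fun y => (⟨y, E i y⟩ : TangentBundle (𝓡 n) M)) x := fun i => mdifferentiableAt_chartExt _
  have key : ∀ s : Finset (Fin p),
      leibnizExpr nabla φ x v (s.piecewise W E) = leibnizExpr nabla φ x v E := by
    intro s
    induction s using Finset.induction_on with
    | empty => simp
    | insert j s hj ih =>
      rw [← ih, Finset.piecewise_insert]
      have hd : ∀ i, MDifferentiableAt (𝓡 n) (𝓡 n).tangent
          (fun y => (⟨y, s.piecewise W E i y⟩ : TangentBundle (𝓡 n) M)) x := by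
        intro i
        by_cases h : i ∈ s
        · simpa [h] using hW i
        · simpa [h] using hEd i
      have h := (tensorialAt_leibnizExpr nabla hφ v hd j).pointwise (hW j) (hEd j)
        (chartExt_self _).symm
      have hu : Function.update (s.piecewise W E) j (E j) = s.piecewise W E := by
        rw [Function.update_eq_self_iff, Finset.piecewise_eq_of_notMem _ _ _ hj]
      simpa only [hu] using h
  have huniv := key Finset.univ
  rw [Finset.piecewise_univ] at huniv
  rw [huniv, PForm.covDeriv, dif_pos hφ, leibnizExpr]
  simp only [hE, chartExt_self]
  rfl

end Manifold

/-! ### Curvature of the induced connection on forms -/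

section Manifold

variable {n : ℕ} {M : Type*} [TopologicalSpace M] [ChartedSpace (EuclideanSpace ℝ (Fin n)) M]

theorem mvfderiv_finsetSum {ι : Type*} (s : Finset ι) {f : ι → M → ℝ} {x : M}
    (hf : ∀ i, MDifferentiableAt (𝓡 n) 𝓘(ℝ, ℝ) (f i) x) (v : TangentSpace (𝓡 n) x) :
    mvfderiv (𝓡 n) (fun y => ∑ i ∈ s, f i y) x v = ∑ i ∈ s, mvfderiv (𝓡 n) (f i) x v := by
  classical
  have hsum : ∀ t : Finset ι, MDifferentiableAt (𝓡 n) 𝓘(ℝ, ℝ) (fun y => ∑ i ∈ t, f i y) x := by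
    intro t
    induction t using Finset.induction_on with
    | empty => simpa using mdifferentiableAt_const
    | insert a t ha ih =>
      simp only [Finset.sum_insert ha]
      exact (hf a).add ih
  induction s using Finset.induction_on with
  | empty => simp [mvfderiv_const]
  | insert a t ha ih =>
    simp only [Finset.sum_insert ha]
    rw [mvfderiv_fun_add (hf a) (hsum t), ← ih]
    rfl

variable [IsManifold (𝓡 n) ∞ M]

theorem contMDiffAt_chartExt {x : M} (v : TangentSpace (𝓡 n) x) :
    ContMDiffAt (𝓡 n) (𝓡 n).tangent ∞
      (fun y => (⟨y, chartExt x v y⟩ : TangentBundle (𝓡 n) M)) x := by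
  refine (FiberBundle.contMDiffAt_extend (𝓡 n) (EuclideanSpace ℝ (Fin n))
    v).congr_of_eventuallyEq ?_
  filter_upwards [chartExt_eventuallyEq v] with y hy
  rw [hy]

theorem PForm.SmoothAt.diffAt {p : ℕ} {φ : PForm n M p} {x : M} (hφ : φ.SmoothAt x) :
    φ.DiffAt x := fun w =>
  (hφ (fun i => chartExt x (w i)) fun i => contMDiffAt_chartExt (w i)).mdifferentiableAt (by simp)

theorem contMDiff_form_apply {p : ℕ} {φ : PForm n M p} (hφ : ∀ x, φ.SmoothAt x)
    {W : Fin p → VField n M} (hW : ∀ i, (W i).Smooth) :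
    ContMDiff (𝓡 n) 𝓘(ℝ, ℝ) ∞ (fun y => φ y (fun i => W i y)) :=
  fun x => hφ x W fun i => hW i x

theorem smooth_update {p : ℕ} {W : Fin p → VField n M} (hW : ∀ i, (W i).Smooth)
    {σ : VField n M} (hσ : σ.Smooth) (i k : Fin p) : (Function.update W i σ k).Smooth := by
  rcases eq_or_ne k i with rfl | h
  · simpa using hσ
  · simpa [h] using hW k

theorem covDeriv_smooth_apply {nabla : Conn n M} {p : ℕ} {φ : PForm n M p} (hφ : ∀ x, φ.SmoothAt x)
    (Y : VField n M) {W : Fin p → VField n M} (hW : ∀ i, (W i).Smooth) (y : M) :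
    φ.covDeriv nabla y (Y y) (fun i => W i y) =
      mvfderiv (𝓡 n) (fun z => φ z (fun i => W i z)) y (Y y) -
      ∑ i, φ y (fun k => Function.update W i (fun z => nabla (W i) z (Y z)) k y) := by
  rw [covDeriv_apply nabla (hφ y).diffAt (Y y) fun i => (hW i).mdifferentiableAt y, leibnizExpr]
  simp only [update_eval]

theorem contMDiff_covDeriv_apply {nabla : Conn n M}
    (hs : CovariantDerivative.ContMDiffCovariantDerivative nabla ∞)
    {p : ℕ} {φ : PForm n M p} (hφ : ∀ x, φ.SmoothAt x)
    {Y : VField n M} (hY : Y.Smooth) {W : Fin p → VField n M} (hW : ∀ i, (W i).Smooth) :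
    ContMDiff (𝓡 n) 𝓘(ℝ, ℝ) ∞ (fun y => φ.covDeriv nabla y (Y y) (fun i => W i y)) := by
  simp only [covDeriv_smooth_apply hφ Y hW]
  refine (contMDiff_mvfderiv (contMDiff_form_apply hφ hW) hY).sub ?_
  exact contMDiff_finsetSum fun i _ =>
    contMDiff_form_apply hφ fun k => smooth_update hW (VField.Smooth.nabla hs hY (hW i)) i k

/-- The chart-constant test fields need not be globally smooth; globally smooth fields agreeing with
them near `x` take their place. -/
theorem diffAt_covDeriv [T2Space M] {nabla : Conn n M}
    (hs : CovariantDerivative.ContMDiffCovariantDerivative nabla ∞)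
    {p : ℕ} {φ : PForm n M p} (hφ : ∀ x, φ.SmoothAt x)
    {Y : VField n M} (hY : Y.Smooth) (x : M) :
    PForm.DiffAt (fun y => φ.covDeriv nabla y (Y y)) x := by
  intro w
  choose W hW hW' using fun i => exists_smooth_eventuallyEq_chartExt (w i)
  refine ((contMDiff_covDeriv_apply hs hφ hY hW x).mdifferentiableAt
    (by simp)).congr_of_eventuallyEq ?_
  filter_upwards [Filter.eventually_all.mpr hW'] with y hy
  simp only [hy]

theorem covDeriv_covDeriv_apply [T2Space M] {nabla : Conn n M}
    (hs : CovariantDerivative.ContMDiffCovariantDerivative nabla ∞)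
    {p : ℕ} {φ : PForm n M p} (hφ : ∀ x, φ.SmoothAt x)
    {X Y : VField n M} (hX : X.Smooth) (hY : Y.Smooth) {W : Fin p → VField n M}
    (hW : ∀ i, (W i).Smooth) (x : M) :
    PForm.covDeriv nabla (fun y => φ.covDeriv nabla y (Y y)) x (X x) (fun i => W i x) =
      mvfderiv (𝓡 n)
        (fun y => mvfderiv (𝓡 n) (fun z => φ z (fun i => W i z)) y (Y y)) x (X x) -
      ∑ i, mvfderiv (𝓡 n) (fun y => φ y
        (fun k => Function.update W i (fun z => nabla (W i) z (Y z)) k y)) x (X x) -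
      ∑ i, mvfderiv (𝓡 n) (fun y => φ y
        (fun k => Function.update W i (fun z => nabla (W i) z (X z)) k y)) x (Y x) +
      ∑ i, ∑ j, φ x (Function.update
        (Function.update (fun k => W k x) i (nabla (W i) x (X x))) j
        (nabla (Function.update W i (fun z => nabla (W i) z (X z)) j) x (Y x))) := by
  have hY' : ∀ i, ContMDiff (𝓡 n) 𝓘(ℝ, ℝ) ∞ (fun y => φ y
      (fun k => Function.update W i (fun z => nabla (W i) z (Y z)) k y)) := fun i =>
    contMDiff_form_apply hφ fun k => smooth_update hW (VField.Smooth.nabla hs hY (hW i)) i k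
  have hsum : mvfderiv (𝓡 n) (fun y => ∑ i, φ y
      (fun k => Function.update W i (fun z => nabla (W i) z (Y z)) k y)) x (X x) =
      ∑ i, mvfderiv (𝓡 n) (fun y => φ y
      (fun k => Function.update W i (fun z => nabla (W i) z (Y z)) k y)) x (X x) := by
    exact mvfderiv_finsetSum _ (fun i => (hY' i x).mdifferentiableAt (by simp)) _
  rw [covDeriv_apply nabla (diffAt_covDeriv hs hφ hY x) (X x)
    fun i => (hW i).mdifferentiableAt x, leibnizExpr]
  have h2 : ∀ i, φ.covDeriv nabla x (Y x)
      (Function.update (fun k => W k x) i (nabla (W i) x (X x))) =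
      mvfderiv (𝓡 n) (fun y => φ y
        (fun k => Function.update W i (fun z => nabla (W i) z (X z)) k y)) x (Y x) -
      ∑ j, φ x (Function.update
        (Function.update (fun k => W k x) i (nabla (W i) x (X x))) j
        (nabla (Function.update W i (fun z => nabla (W i) z (X z)) j) x (Y x))) := by
    intro i
    have h := covDeriv_apply nabla (hφ x).diffAt (Y x)
      (W := Function.update W i (fun z => nabla (W i) z (X z)))
      fun k => (smooth_update hW (VField.Smooth.nabla hs hX (hW i)) i k).mdifferentiableAt x
    rw [leibnizExpr] at h
    simpa only [update_eval] using h
  simp only [h2, Finset.sum_sub_distrib]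
  simp only [covDeriv_smooth_apply hφ Y hW]
  rw [mvfderiv_fun_sub, _root_.sub_apply, hsum]
  · ring
  · exact (contMDiff_mvfderiv (contMDiff_form_apply hφ hW) hY x).mdifferentiableAt (by simp)
  · exact (contMDiff_finsetSum (fun i _ => hY' i) x).mdifferentiableAt (by simp)

/-- The sums of first derivatives in the second covariant derivative are symmetric in `X, Y` and
cancel. The pure second derivatives cancel against the `[X, Y]` term, leaving curvature inserted in
one slot at a time. -/
theorem covDeriv_commutator_apply [T2Space M] {nabla : Conn n M}
    (hs : CovariantDerivative.ContMDiffCovariantDerivative nabla ∞)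
    {p : ℕ} {φ : PForm n M p}
    (hφ : ∀ x, φ.SmoothAt x) {X Y : VField n M} (hX : X.Smooth) (hY : Y.Smooth)
    {W : Fin p → VField n M} (hW : ∀ i, (W i).Smooth) (x : M) :
    PForm.covDeriv nabla (fun y => φ.covDeriv nabla y (Y y)) x (X x) (fun i => W i x) -
      PForm.covDeriv nabla (fun y => φ.covDeriv nabla y (X y)) x (Y x) (fun i => W i x) -
      φ.covDeriv nabla x (mlieBracket (𝓡 n) X Y x) (fun i => W i x) =
    -∑ i, φ x (Function.update (fun k => W k x) i (tangentCurvature nabla X Y (W i) x)) := by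
  rw [covDeriv_covDeriv_apply hs hφ hX hY hW, covDeriv_covDeriv_apply hs hφ hY hX hW,
    covDeriv_apply nabla (hφ x).diffAt _ fun i => (hW i).mdifferentiableAt x, leibnizExpr,
    mvfderiv_mlieBracket (contMDiff_form_apply hφ hW) hX hY]
  -- After exchanging the indices in one double sum, terms modifying two different slots cancel; on
  -- the diagonal one slot is differentiated twice.
  have hQ : ∑ i, ∑ j, φ x (Function.update
        (Function.update (fun k => W k x) i (nabla (W i) x (X x))) j
        (nabla (Function.update W i (fun z => nabla (W i) z (X z)) j) x (Y x))) -
      ∑ i, ∑ j, φ x (Function.update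
        (Function.update (fun k => W k x) i (nabla (W i) x (Y x))) j
        (nabla (Function.update W i (fun z => nabla (W i) z (Y z)) j) x (X x))) =
      ∑ i, (φ x (Function.update (fun k => W k x) i
          (nabla (fun z => nabla (W i) z (X z)) x (Y x))) -
        φ x (Function.update (fun k => W k x) i
          (nabla (fun z => nabla (W i) z (Y z)) x (X x)))) := by
    rw [Finset.sum_comm (f := fun i j => φ x (Function.update
        (Function.update (fun k => W k x) i (nabla (W i) x (Y x))) j
        (nabla (Function.update W i (fun z => nabla (W i) z (Y z)) j) x (X x)))),
      ← Finset.sum_sub_distrib]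
    refine Finset.sum_congr rfl fun i _ => ?_
    rw [← Finset.sum_sub_distrib, Finset.sum_eq_single i]
    · simp
    · intro j _ hij
      simp only [Function.update_of_ne hij, Function.update_of_ne hij.symm]
      rw [Function.update_comm hij, sub_self]
    · simp
  have hR : ∀ i, φ x (Function.update (fun k => W k x) i (tangentCurvature nabla X Y (W i) x)) =
      φ x (Function.update (fun k => W k x) i (nabla (fun z => nabla (W i) z (Y z)) x (X x))) -
      φ x (Function.update (fun k => W k x) i (nabla (fun z => nabla (W i) z (X z)) x (Y x))) -
      φ x (Function.update (fun k => W k x) i (nabla (W i) x (mlieBracket (𝓡 n) X Y x))) := by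
    intro i
    rw [tangentCurvature, AlternatingMap.map_update_sub, AlternatingMap.map_update_sub]
  simp only [hR, Finset.sum_sub_distrib] at hQ ⊢
  linarith

end Manifold

/-! ### Symmetries of the tangent curvature -/

section Manifold

variable {n : ℕ} {M : Type*} [TopologicalSpace M] [ChartedSpace (EuclideanSpace ℝ (Fin n)) M]
  [IsManifold (𝓡 n) ∞ M]

section Curvature

variable {nabla : Conn n M}

theorem tangentCurvature_swap (X Y Z : VField n M) (x : M) :
    tangentCurvature nabla X Y Z x = -tangentCurvature nabla Y X Z x := by
  simp only [tangentCurvature, mlieBracket_swap_apply (V := X) (W := Y), map_neg]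
  abel

theorem tangentCurvature_add_middle
    (hs : CovariantDerivative.ContMDiffCovariantDerivative nabla ∞) {X Y Y' Z : VField n M}
    (hY : Y.Smooth) (hY' : Y'.Smooth) (hZ : Z.Smooth) (x : M) :
    tangentCurvature nabla X (Y + Y') Z x =
      tangentCurvature nabla X Y Z x + tangentCurvature nabla X Y' Z x := by
  have h : (fun y => nabla Z y ((Y + Y') y)) =
      (fun y => nabla Z y (Y y)) + fun y => nabla Z y (Y' y) := by
    funext y; simp
  simp only [tangentCurvature, h]
  rw [nabla.isCovariantDerivativeOn.add ((VField.Smooth.nabla hs hY hZ).mdifferentiableAt x)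
    ((VField.Smooth.nabla hs hY' hZ).mdifferentiableAt x),
    mlieBracket_add_right (hY.mdifferentiableAt x) (hY'.mdifferentiableAt x)]
  simp only [_root_.add_apply, map_add, Pi.add_apply]
  abel

theorem tangentCurvature_add_right
    (hs : CovariantDerivative.ContMDiffCovariantDerivative nabla ∞) {X Y Z Z' : VField n M}
    (hX : X.Smooth) (hY : Y.Smooth) (hZ : Z.Smooth) (hZ' : Z'.Smooth) (x : M) :
    tangentCurvature nabla X Y (Z + Z') x =
      tangentCurvature nabla X Y Z x + tangentCurvature nabla X Y Z' x := by
  have h : ∀ A : VField n M, (fun y => nabla (Z + Z') y (A y)) =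
      (fun y => nabla Z y (A y)) + fun y => nabla Z' y (A y) := by
    intro A
    funext y
    rw [nabla.isCovariantDerivativeOn.add (hZ.mdifferentiableAt y) (hZ'.mdifferentiableAt y)]
    simp
  simp only [tangentCurvature, h]
  rw [nabla.isCovariantDerivativeOn.add ((VField.Smooth.nabla hs hY hZ).mdifferentiableAt x)
    ((VField.Smooth.nabla hs hY hZ').mdifferentiableAt x),
    nabla.isCovariantDerivativeOn.add ((VField.Smooth.nabla hs hX hZ).mdifferentiableAt x)
    ((VField.Smooth.nabla hs hX hZ').mdifferentiableAt x),
    nabla.isCovariantDerivativeOn.add (hZ.mdifferentiableAt x) (hZ'.mdifferentiableAt x)]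
  simp only [_root_.add_apply]
  abel

theorem tangentCurvature_smul_self
    (hs : CovariantDerivative.ContMDiffCovariantDerivative nabla ∞) {X Z : VField n M} (c : ℝ)
    (hX : X.Smooth) (hZ : Z.Smooth) (x : M) :
    tangentCurvature nabla X (c • X) Z x = 0 := by
  have h : (fun y => nabla Z y ((c • X) y)) = c • fun y => nabla Z y (X y) := by
    funext y; simp
  simp only [tangentCurvature, h]
  rw [nabla.isCovariantDerivativeOn.smul_const c
    ((VField.Smooth.nabla hs hX hZ).mdifferentiableAt x),
    mlieBracket_const_smul_right (hX.mdifferentiableAt x)]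
  simp

/-- For a torsion-free connection every bracket is `∇_A B - ∇_B A`; substituting this into the
Jacobi identity gives the first Bianchi identity. -/
theorem bianchi (hs : CovariantDerivative.ContMDiffCovariantDerivative nabla ∞)
    (ht : CovariantDerivative.torsion nabla = 0) {X Y Z : VField n M}
    (hX : X.Smooth) (hY : Y.Smooth) (hZ : Z.Smooth) (x : M) :
    tangentCurvature nabla X Y Z x + tangentCurvature nabla Y Z X x +
      tangentCurvature nabla Z X Y x = 0 := by
  have hbr : ∀ {A B : VField n M}, A.Smooth → B.Smooth → mlieBracket (𝓡 n) A B =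
      (fun y => nabla B y (A y)) - fun y => nabla A y (B y) := fun hA hB =>
    funext fun y => mlieBracket_eq ht hA hB y
  have hnn : ∀ {A B C : VField n M}, A.Smooth → B.Smooth → C.Smooth →
      mlieBracket (𝓡 n) A (mlieBracket (𝓡 n) B C) x =
        nabla (fun y => nabla C y (B y)) x (A x) - nabla (fun y => nabla B y (C y)) x (A x) -
          nabla A x (mlieBracket (𝓡 n) B C x) := by
    intro A B C hA hB hC
    have hsub := nabla.isCovariantDerivativeOn.add (x := x)
      ((hB.mlieBracket hC).mdifferentiableAt x)
      ((VField.Smooth.nabla hs hC hB).mdifferentiableAt x)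
    -- Writing `[B, C] + ∇_C B = ∇_B C` reduces the derivative of a difference to additivity of
    -- `nabla`.
    have e : mlieBracket (𝓡 n) B C + (fun y => nabla B y (C y)) = fun y => nabla C y (B y) := by
      rw [hbr hB hC, sub_add_cancel]
    rw [e] at hsub
    rw [mlieBracket_eq ht hA (hB.mlieBracket hC), hsub]
    simp
  have hj := jacobi hX hY hZ x
  rw [mlieBracket_swap_apply (V := mlieBracket (𝓡 n) X Y), hnn hX hY hZ, hnn hZ hX hY,
    hnn hY hX hZ] at hj
  rw [← sub_eq_zero] at hj
  simp only [tangentCurvature, mlieBracket_swap_apply (V := Z) (W := X), map_neg]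
  rw [← hj]
  abel

variable [RiemannianBundle (fun x : M => TangentSpace (𝓡 n) x)]
  [IsContMDiffRiemannianBundle (𝓡 n) ∞ (EuclideanSpace ℝ (Fin n))
    (fun x : M => TangentSpace (𝓡 n) x)]

set_option synthInstance.maxHeartbeats 400000 in
theorem mvfderiv_inner (hm : CovariantDerivative.IsMetricCompatible nabla) (X : VField n M)
    {Y Z : VField n M} (hY : Y.Smooth) (hZ : Z.Smooth) (x : M) :
    mvfderiv (𝓡 n) (fun y => inner ℝ (Y y) (Z y)) x (X x) =
      inner ℝ (nabla Y x (X x)) (Z x) + inner ℝ (Y x) (nabla Z x (X x)) :=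
  hm.mvfderiv_inner_eq X (hY.mdifferentiableAt x) (hZ.mdifferentiableAt x)

/-- Apply `[X, Y]f = X(Yf) - Y(Xf)` to `f = |Z|²`: metric compatibility turns it into `⟨R(X, Y)Z, Z⟩
= 0`, as the products `⟨∇_X Z, ∇_Y Z⟩` cancel. -/
theorem inner_tangentCurvature_self [T2Space M] (h : IsLeviCivita nabla) {X Y Z : VField n M}
    (hX : X.Smooth) (hY : Y.Smooth) (hZ : Z.Smooth) (x : M) :
    inner ℝ (tangentCurvature nabla X Y Z x) (Z x) = 0 := by
  have hf : ContMDiff (𝓡 n) 𝓘(ℝ, ℝ) ∞ (fun y => (inner ℝ (Z y) (Z y) : ℝ)) :=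
    ContMDiff.inner_bundle hZ hZ
  -- The factor two is carried by the field `Z + Z`, so that the right side is again an inner
  -- product of two smooth fields and can be differentiated once more.
  have h1 : ∀ {A : VField n M}, A.Smooth →
      (fun y => mvfderiv (𝓡 n) (fun y => (inner ℝ (Z y) (Z y) : ℝ)) y (A y)) =
      fun y => inner ℝ (nabla Z y (A y)) ((Z + Z) y) := by
    intro A hA
    funext y
    rw [mvfderiv_inner h.metric A hZ hZ, Pi.add_apply, inner_add_right,
      real_inner_comm (nabla Z y (A y)) (Z y)]
  have hc := mvfderiv_mlieBracket hf hX hY x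
  have h2 := congrFun (h1 (hX.mlieBracket hY)) x
  have hZZ := hZ.add hZ
  rw [h2, h1 hX, h1 hY, mvfderiv_inner h.metric X (VField.Smooth.nabla h.smooth hY hZ) hZZ,
    mvfderiv_inner h.metric Y (VField.Smooth.nabla h.smooth hX hZ) hZZ,
    nabla.isCovariantDerivativeOn.add (hZ.mdifferentiableAt x) (hZ.mdifferentiableAt x)] at hc
  simp only [Pi.add_apply, _root_.add_apply, inner_add_right] at hc
  rw [real_inner_comm (nabla Z x (X x)) (nabla Z x (Y x))] at hc
  simp only [tangentCurvature, inner_sub_left]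
  linarith

end Curvature
end Manifold

/-! ### Frame extensions and locality -/

section Manifold

variable {n : ℕ} {M : Type*} [TopologicalSpace M] [ChartedSpace (EuclideanSpace ℝ (Fin n)) M]

section Frame

variable [RiemannianBundle (fun x : M => TangentSpace (𝓡 n) x)]

/-- The extension of tangent vectors to vector fields with constant coefficients in `e'`, where the
coefficients of a tangent vector are its components with respect to `b`. -/
def frameExt {x : M} (b : OrthonormalBasis (Fin n) ℝ (TangentSpace (𝓡 n) x))
    (e' : Fin n → VField n M) : TangentSpace (𝓡 n) x →ₗ[ℝ] VField n M :=
  ∑ i, (innerₗ (TangentSpace (𝓡 n) x) (b i)).smulRight (e' i)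

theorem frameExt_apply {x : M} (b : OrthonormalBasis (Fin n) ℝ (TangentSpace (𝓡 n) x))
    (e' : Fin n → VField n M) (v : TangentSpace (𝓡 n) x) :
    frameExt b e' v = ∑ i, (inner ℝ (b i) v : ℝ) • e' i := by
  simp [frameExt]

theorem frameExt_basis {x : M} (b : OrthonormalBasis (Fin n) ℝ (TangentSpace (𝓡 n) x))
    (e' : Fin n → VField n M) (i : Fin n) : frameExt b e' (b i) = e' i := by
  simp [frameExt_apply, orthonormal_iff_ite.mp b.orthonormal]

theorem frameExt_self {x : M} (b : OrthonormalBasis (Fin n) ℝ (TangentSpace (𝓡 n) x))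
    {e' : Fin n → VField n M} (he : ∀ i, e' i x = b i) (v : TangentSpace (𝓡 n) x) :
    frameExt b e' v x = v := by
  rw [frameExt_apply, Finset.sum_apply]
  simp only [Pi.smul_apply, he]
  exact b.sum_repr' v

end Frame

variable [IsManifold (𝓡 n) ∞ M]

section Locality

variable {nabla : Conn n M}

theorem PForm.covDeriv_congr {p : ℕ} {φ ψ : PForm n M p} {x : M} (h : ∀ᶠ y in nhds x, φ y = ψ y)
    (v : TangentSpace (𝓡 n) x) : φ.covDeriv nabla x v = ψ.covDeriv nabla x v := by
  have hcomp : ∀ w : Fin p → TangentSpace (𝓡 n) x,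
      (fun y => φ y (fun i => chartExt x (w i) y)) =ᶠ[nhds x]
        fun y => ψ y (fun i => chartExt x (w i) y) := by
    intro w
    filter_upwards [h] with y hy
    rw [hy]
  have hdiff : φ.DiffAt x ↔ ψ.DiffAt x :=
    forall_congr' fun w => (hcomp w).mdifferentiableAt_iff
  by_cases hφ : φ.DiffAt x
  · have hψ := hdiff.mp hφ
    rw [PForm.covDeriv, PForm.covDeriv, dif_pos hφ, dif_pos hψ, h.self_of_nhds]
    congr 1
    ext w
    simp only [PForm.compDeriv, AlternatingMap.coe_mk, MultilinearMap.coe_mk, mvfderiv,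
      (hcomp w).mfderiv_eq]
    rfl
  -- Where neither form is differentiable, both derivatives take the default value zero.
  · rw [PForm.covDeriv, PForm.covDeriv, dif_neg hφ, dif_neg (mt hdiff.mpr hφ)]

theorem MixedForm.covDeriv_congr {σ τ : MixedForm n M} {x : M} (h : ∀ᶠ y in nhds x, σ y = τ y)
    (v : TangentSpace (𝓡 n) x) : σ.covDeriv nabla x v = τ.covDeriv nabla x v := by
  funext p
  refine PForm.covDeriv_congr ?_ v
  filter_upwards [h] with y hy
  rw [hy]

theorem exteriorCurvature_congr {σ τ : MixedForm n M} {X X' Y Y' : VField n M} {x : M}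
    (hσ : ∀ᶠ y in nhds x, σ y = τ y) (hX : X =ᶠ[nhds x] X') (hY : Y =ᶠ[nhds x] Y') :
    exteriorCurvature nabla X Y σ x = exteriorCurvature nabla X' Y' τ x := by
  -- The inner derivatives are differentiated again, so they must agree on a neighbourhood of `x`,
  -- not just at `x`.
  have hcov : ∀ {A A' : VField n M}, A =ᶠ[nhds x] A' →
      ∀ᶠ y in nhds x, σ.covDeriv nabla y (A y) = τ.covDeriv nabla y (A' y) := by
    intro A A' hA
    filter_upwards [hσ.eventually_nhds, hA] with y hy hAy
    rw [MixedForm.covDeriv_congr hy, hAy]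
  simp only [exteriorCurvature]
  rw [MixedForm.covDeriv_congr (hcov hY), MixedForm.covDeriv_congr (hcov hX),
    MixedForm.covDeriv_congr hσ, hX.mlieBracket_vectorField_eq hY, hX.self_of_nhds,
    hY.self_of_nhds]

theorem PForm.SmoothAt.congr {p : ℕ} {φ ψ : PForm n M p} {x : M} (hφ : φ.SmoothAt x)
    (h : ∀ᶠ y in nhds x, ψ y = φ y) : ψ.SmoothAt x := by
  intro Y hY
  refine (hφ Y hY).congr_of_eventuallyEq ?_
  filter_upwards [h] with y hy
  rw [hy]

theorem smoothAt_zero (p : ℕ) (x : M) : PForm.SmoothAt (fun _ => 0 : PForm n M p) x := by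
  intro Y _
  simpa using contMDiffAt_const

theorem exists_smooth_form_extension [T2Space M] {U : Set M} (hU : IsOpen U) {p : ℕ}
    {φ : PForm n M p} (hφ : ∀ x ∈ U, φ.SmoothAt x) {x : M} (hx : x ∈ U) :
    ∃ ψ : PForm n M p, (∀ y, ψ.SmoothAt y) ∧ ∀ᶠ y in nhds x, ψ y = φ y := by
  obtain ⟨χ, hχ⟩ :=
    (SmoothBumpFunction.nhds_basis_tsupport (I := 𝓡 n) x).mem_iff.mp (hU.mem_nhds hx)
  refine ⟨fun y => χ y • φ y, fun y => ?_, ?_⟩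
  · by_cases hy : y ∈ U
    · intro Y hY
      exact (χ.contMDiff y).smul (hφ y hy Y hY)
    -- Nothing is known about `φ` outside `U`, but there the cut-off form vanishes near `y`.
    · refine (smoothAt_zero p y).congr ?_
      have : y ∈ (tsupport χ)ᶜ := fun h => hy (hχ.2 h)
      filter_upwards [(isClosed_tsupport χ).isOpen_compl.mem_nhds this] with z hz
      rw [image_eq_zero_of_notMem_tsupport hz, zero_smul]
  · filter_upwards [χ.eventuallyEq_one] with y hy
    rw [hy]
    exact one_smul ℝ (φ y)

theorem toMixed_smoothAt {p : ℕ} {φ : PForm n M p} (hφ : ∀ x, φ.SmoothAt x) (q : ℕ) (x : M) :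
    PForm.SmoothAt (fun y => φ.toMixed y q) x := by
  rcases eq_or_ne q p with rfl | h
  · simpa [PForm.toMixed] using hφ x
  · simpa [PForm.toMixed, Pi.single_eq_of_ne h] using smoothAt_zero q x

end Locality

/-! ### Curvature under constant sectional curvature -/

variable [RiemannianBundle (fun x : M => TangentSpace (𝓡 n) x)]

theorem inner_tangentCurvature_of_sectional {nabla : Conn n M} {κ : ℝ}
    (hκ : HasConstantSectionalCurvature nabla κ) {X Y : VField n M} (hX : X.Smooth)
    (hY : Y.Smooth) (x : M) (hli : LinearIndependent ℝ ![X x, Y x]) :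
    inner ℝ (tangentCurvature nabla X Y Y x) (X x) =
      κ * (‖X x‖ ^ 2 * ‖Y x‖ ^ 2 - inner ℝ (X x) (Y x) ^ 2) := by
  have h := hκ X Y hX.smoothOn hY.smoothOn x hli
  rw [sectionalCurvature, div_eq_iff] at h
  · exact h
  -- A vanishing denominator is the equality case of Cauchy–Schwarz, which makes `Y x` a multiple of
  -- `X x`.
  · intro h0
    have h1 : ‖(inner ℝ (X x) (Y x) : ℝ)‖ = ‖X x‖ * ‖Y x‖ := by
      rw [Real.norm_eq_abs, ← abs_of_nonneg (by positivity : (0:ℝ) ≤ ‖X x‖ * ‖Y x‖),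
        ← sq_eq_sq_iff_abs_eq_abs]
      linarith [mul_pow ‖X x‖ ‖Y x‖ 2]
    have hX0 : X x ≠ 0 := by simpa using hli.ne_zero 0
    have hY0 : Y x ≠ 0 := by simpa using hli.ne_zero 1
    obtain ⟨-, r, -, hr⟩ := (abs_real_inner_div_norm_mul_norm_eq_one_iff (X x) (Y x)).mp (by
      rw [abs_div, ← Real.norm_eq_abs, h1, abs_of_nonneg (by positivity)]
      exact div_self (mul_ne_zero (norm_ne_zero_iff.mpr hX0) (norm_ne_zero_iff.mpr hY0)))
    have := (LinearIndependent.pair_iff.mp hli) r (-1) (by rw [hr]; simp)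
    simp at this

theorem frameExt_smooth {x : M} (b : OrthonormalBasis (Fin n) ℝ (TangentSpace (𝓡 n) x))
    {e' : Fin n → VField n M} (he : ∀ i, (e' i).Smooth) (v : TangentSpace (𝓡 n) x) :
    (frameExt b e' v).Smooth := by
  rw [frameExt_apply]
  have h := ContMDiff.sum_section (s := Finset.univ) (t := fun i => (inner ℝ (b i) v : ℝ) • e' i)
    fun i _ => VField.Smooth.const_smul (inner ℝ (b i) v : ℝ) (he i)
  simpa only [VField.Smooth, Finset.sum_apply] using h

variable [IsContMDiffRiemannianBundle (𝓡 n) ∞ (EuclideanSpace ℝ (Fin n))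
  (fun x : M => TangentSpace (𝓡 n) x)]

/-- Tangent vectors are extended linearly, with constant coefficients in `e'`. Additivity of the
curvature on fields then suffices to obtain an algebraic curvature tensor on `T_x M`, without
linearity over functions. -/
theorem tangentCurvature_frameExt [T2Space M] {nabla : Conn n M} (hn : IsLeviCivita nabla) {κ : ℝ}
    (hκ : HasConstantSectionalCurvature nabla κ) {x : M}
    (b : OrthonormalBasis (Fin n) ℝ (TangentSpace (𝓡 n) x)) {e' : Fin n → VField n M}
    (he : ∀ i, (e' i).Smooth) (hb : ∀ i, e' i x = b i) (u v w : TangentSpace (𝓡 n) x) :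
    tangentCurvature nabla (frameExt b e' u) (frameExt b e' v) (frameExt b e' w) x =
      constCurvEnd κ u v w := by
  have hF : ∀ v, (frameExt b e' v).Smooth := frameExt_smooth b he
  have hFx : ∀ v, frameExt b e' v x = v := frameExt_self b hb
  refine ext_inner_right ℝ fun z => ?_
  rw [curvature_eq_of_sectional (fun u v w z => inner ℝ
    (tangentCurvature nabla (frameExt b e' u) (frameExt b e' v) (frameExt b e' w) x) z) κ
    ?_ ?_ ?_ ?_ ?_ ?_ u v w z]
  · rw [constCurvEnd_apply, inner_smul_left, inner_sub_left, inner_smul_left, inner_smul_left]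
    simp
  · intro a c c' d z
    rw [map_add, tangentCurvature_add_middle hn.smooth (hF c) (hF c') (hF d), inner_add_left]
  · intro a c d z z'
    rw [inner_add_right]
  · intro a c d z
    rw [tangentCurvature_swap, inner_neg_left]
  · intro a c d z
    have hself : ∀ d, inner ℝ
        (tangentCurvature nabla (frameExt b e' a) (frameExt b e' c) (frameExt b e' d) x) d = 0 := by
      intro d
      have h := inner_tangentCurvature_self hn (hF a) (hF c) (hF d) x
      rwa [hFx] at h
    have h := hself (d + z)
    rw [map_add, tangentCurvature_add_right hn.smooth (hF a) (hF c) (hF d) (hF z), inner_add_left,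
      inner_add_right, inner_add_right, hself, hself] at h
    linarith
  · intro a c d z
    rw [← inner_add_left, ← inner_add_left, bianchi hn.smooth hn.torsion_free (hF a) (hF c) (hF d),
      inner_zero_left]
  · intro a c
    by_cases hli : LinearIndependent ℝ ![a, c]
    · have h := inner_tangentCurvature_of_sectional hκ (hF a) (hF c) x (by simpa only [hFx] using hli)
      simpa only [hFx] using h
    -- Sectional curvature says nothing about dependent pairs; for these both the curvature and the
    -- Gram determinant vanish.
    · have hzero : tangentCurvature nabla (frameExt b e' a) (frameExt b e' c)
          (frameExt b e' c) x = 0 ∧ ‖a‖ ^ 2 * ‖c‖ ^ 2 - inner ℝ a c ^ 2 = 0 := by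
        by_cases ha : a = 0
        · constructor
          · have h := tangentCurvature_smul_self hn.smooth 0 (hF c) (hF c) x
            rw [tangentCurvature_swap, ha, map_zero, ← zero_smul ℝ (frameExt b e' c), h, neg_zero]
          · simp [ha]
        · rw [LinearIndependent.pair_iff' ha] at hli
          push Not at hli
          obtain ⟨r, rfl⟩ := hli
          constructor
          · rw [map_smul]
            exact tangentCurvature_smul_self hn.smooth r (hF a)
              (VField.Smooth.const_smul r (hF a)) x
          · rw [inner_smul_right, real_inner_self_eq_norm_sq, norm_smul, mul_pow, Real.norm_eq_abs,
              sq_abs]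
            ring
      rw [hzero.1, hzero.2, inner_zero_left, mul_zero]

theorem exteriorCurvature_eq [T2Space M] {nabla : Conn n M} (hn : IsLeviCivita nabla) {κ : ℝ}
    (hκ : HasConstantSectionalCurvature nabla κ) {x : M}
    (b : OrthonormalBasis (Fin n) ℝ (TangentSpace (𝓡 n) x)) {e' : Fin n → VField n M}
    (he : ∀ i, (e' i).Smooth) (hb : ∀ i, e' i x = b i) {σ : MixedForm n M}
    (hσ : ∀ q x, PForm.SmoothAt (fun y => σ y q) x) (i j : Fin n) :
    exteriorCurvature nabla (e' i) (e' j) σ x =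
      -derivationEnd (constCurvEnd κ (b i) (b j)) (σ x) := by
  funext q
  ext w
  have hF := frameExt_smooth b he
  have h := covDeriv_commutator_apply hn.smooth (hσ q) (he i) (he j)
    (W := fun k => frameExt b e' (w k)) (fun k => hF (w k)) x
  simp only [frameExt_self b hb] at h
  refine h.trans ?_
  rw [Pi.neg_apply, AlternatingMap.neg_apply]
  congr 1
  refine Finset.sum_congr rfl fun k _ => ?_
  rw [← tangentCurvature_frameExt hn hκ b he hb, frameExt_basis, frameExt_basis]

end Manifold
end CliffordForms

end

/-! ### The Weitzenböck operator in a local frame -/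

theorem mainTheorem9 {n : ℕ} {M : Type*} [TopologicalSpace M] [T2Space M]
    [ChartedSpace (EuclideanSpace ℝ (Fin n)) M] [IsManifold (𝓡 n) ∞ M]
    [RiemannianBundle (fun x : M => TangentSpace (𝓡 n) x)]
    [IsContMDiffRiemannianBundle (𝓡 n) ∞ (EuclideanSpace ℝ (Fin n))
      (fun x : M => TangentSpace (𝓡 n) x)]
    (nabla : CliffordForms.Conn n M) (hnabla : CliffordForms.IsLeviCivita nabla)
    (κ : ℝ) (hκ : CliffordForms.HasConstantSectionalCurvature nabla κ)
    (U : Set M) (hU : IsOpen U)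
    (e : Fin n → CliffordForms.VField n M) (he : CliffordForms.IsOrthonormalFrameOn e U)
    (p : ℕ) (φ : CliffordForms.PForm n M p) (hφ : ∀ x ∈ U, φ.SmoothAt x) :
    ∀ x ∈ U, CliffordForms.weitzenbock nabla e φ.toMixed x =
      CliffordForms.PForm.toMixed (fun y => (κ * p * ((n : ℝ) - p)) • φ y) x := by
  intro x hx
  choose e' he' hee' using fun i =>
    CliffordForms.exists_smooth_extension hU (he.1 i) hx
  obtain ⟨ψ, hψ, hψφ⟩ := CliffordForms.exists_smooth_form_extension hU hφ hx
  have hon : Orthonormal ℝ (fun i => e i x) := he.2 x hx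
  have hfin : Module.finrank ℝ (TangentSpace (𝓡 n) x) = n :=
    finrank_euclideanSpace_fin (𝕜 := ℝ) (n := n)
  have : FiniteDimensional ℝ (TangentSpace (𝓡 n) x) :=
    inferInstanceAs (FiniteDimensional ℝ (EuclideanSpace ℝ (Fin n)))
  have hspan : ⊤ ≤ Submodule.span ℝ (Set.range fun i => e i x) :=
    (hon.linearIndependent.span_eq_top_of_card_eq_finrank' (by simp [hfin])).ge
  set b : OrthonormalBasis (Fin n) ℝ (TangentSpace (𝓡 n) x) :=
    OrthonormalBasis.mk hon hspan with hbdef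
  have hb : ∀ i, b i = e i x := fun i => by simp [hbdef]
  have hb' : ∀ i, e' i x = b i := fun i => by rw [hb, (hee' i).self_of_nhds]
  have hmixed : ∀ᶠ y in nhds x, φ.toMixed y = ψ.toMixed y := by
    filter_upwards [hψφ] with y hy
    simp only [CliffordForms.PForm.toMixed, hy]
  have hcurv : ∀ i j, CliffordForms.exteriorCurvature nabla (e i) (e j) φ.toMixed x =
      -CliffordForms.derivationEnd (CliffordForms.constCurvEnd κ (b i) (b j)) (φ.toMixed x) := by
    intro i j
    -- Pass to the global extensions `e'` and `ψ`, compute the curvature there, and return to `φ` by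
    -- its value at `x`.
    rw [CliffordForms.exteriorCurvature_congr hmixed (hee' i).symm (hee' j).symm,
      CliffordForms.exteriorCurvature_eq hnabla hκ b he' hb' (CliffordForms.toMixed_smoothAt hψ),
      hmixed.self_of_nhds]
  simp only [CliffordForms.weitzenbock, hcurv, ← hb]
  rw [CliffordForms.sum_cliffordAction_derivationEnd]
  funext q
  -- The scalar found in degree `q` is `κ q (n - q)`; only `q = p` matters, since the form vanishes
  -- in the other degrees.
  rcases eq_or_ne q p with rfl | hq
  · simp [CliffordForms.PForm.toMixed]
  · simp [CliffordForms.PForm.toMixed, Pi.single_eq_of_ne hq]
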